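/- Let $G$ be a compact Lie group (possibly disconnected) acting smoothly and transitively by isometries on a compact connected Riemannian manifold $M$ of dimension $m$. Assume that $M$ is isotropy irreducible: the stabilizer $H$ of a base point $o\in M$ has no proper nonzero invariant subspace in $T_oM$. Equip $M$ with the $G$-invariant probability measure, let $L^2(M)$ be the corresponding space of real functions, and let $\Delta$ be the Laplace--Beltrami operator of $M$. Let $\mathcal E\neq 0$ be a finite-dimensional $G$-invariant linear subspace of $L^2(M)$ orthogonal to the constant functions. The elements of $\mathcal E$ are (represented by) smooth functions, and $\Delta\mathcal E\subseteq\mathcal E$. For $p\in M$ let $\phi_p\in\mathcal E$ be the vector with $\langle \phi_p,u\rangle=u(p)$ for all $u\in\mathcal E$; then $\phi_p\ne0$, and the map $\iota\colon M\to\mathcal S$, $\iota(p)=\phi_p/|\phi_p|$, into the unit sphere $\mathcal S$ of $\mathcal E$ is a smooth local homothety: there is a unique $s=s(\mathcal E)>0$ such that $|d_p\iota(v)|=s|v|$ for all $p\in M$, $v\in T_pM$. There is an orthogonal decomposition $\mathcal E=\mathcal E^1\oplus\dots\oplus\mathcal E^l$ into nonzero $G$-invariant subspaces such that $\Delta u=-\lambda_j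 u$ for $u\in\mathcal E^j$, with real numbers $\lambda_1,\dots,\lambda_l$ that need not be distinct. For every such decomposition, with $\alpha_j=\dim\mathcal E^j/\dim\mathcal E$ and $s_j=s(\mathcal E^j)$ (the scaling factor defined as above for $\mathcal E^j$ in place of $\mathcal E$), $$s^2=\alpha_1s_1^2+\dots+\alpha_ls_l^2=\frac{|\operatorname{Tr}\Delta|}{m\,\dim\mathcal E},$$ where $\operatorname{Tr}\Delta$ is the trace of $\Delta$ on $\mathcal E$. In particular, if $\Delta u=-\lambda u$ for all $u\in\mathcal E$, then $s=\sqrt{\lambda/m}$. -/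

import Mathlib

open MeasureTheory
open scoped Manifold ContDiff Matrix

noncomputable section

section RiemannianGeometry

variable {m : ℕ} {M : Type*} [TopologicalSpace M] [ChartedSpace (EuclideanSpace ℝ (Fin m)) M]
  [IsManifold (𝓡 m) ∞ M]

/-- A smooth Riemannian metric on an `m`-dimensional manifold `M`. -/
abbrev RiemMetric (m : ℕ) (M : Type*) [TopologicalSpace M]
    [ChartedSpace (EuclideanSpace ℝ (Fin m)) M] [IsManifold (𝓡 m) ∞ M] : Type _ :=
  Bundle.ContMDiffRiemannianMetric (𝓡 m) ∞ (EuclideanSpace ℝ (Fin m))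
    (fun x : M => TangentSpace (𝓡 m) x)

/-- The length `|v|` of a tangent vector. -/
def RiemMetric.tangentNorm (g : RiemMetric m M) (p : M) (v : TangentSpace (𝓡 m) p) : ℝ :=
  √(g.inner p v v)

/-- The coordinate vector field `∂_i` of the chart at `p`, at the point with coordinates `y`. -/
def coordVec (p : M) (y : EuclideanSpace ℝ (Fin m)) (i : Fin m) :
    TangentSpace (𝓡 m) ((extChartAt (𝓡 m) p).symm y) :=
  mfderiv (𝓡 m) (𝓡 m) (extChartAt (𝓡 m) p).symm y
    (EuclideanSpace.single i (1 : ℝ) : EuclideanSpace ℝ (Fin m))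

/-- The matrix `(g_ij)` of the metric in the chart at `p`. -/
def RiemMetric.gram (g : RiemMetric m M) (p : M) (y : EuclideanSpace ℝ (Fin m)) :
    Matrix (Fin m) (Fin m) ℝ :=
  Matrix.of fun i j => g.inner ((extChartAt (𝓡 m) p).symm y) (coordVec p y i) (coordVec p y j)

/-- The partial derivative `∂_i F (y)` of a function on `ℝ^m`. -/
def partialDeriv (i : Fin m) (F : EuclideanSpace ℝ (Fin m) → ℝ)
    (y : EuclideanSpace ℝ (Fin m)) : ℝ :=
  fderiv ℝ F y (EuclideanSpace.single i 1)

/-- The Laplace--Beltrami operator (with the sign making it nonpositive),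
`Δ f = (det g)^(-1/2) ∑ i j, ∂_i ((det g)^(1/2) g^{ij} ∂_j f)`,
evaluated at `p` in the chart at `p`. -/
def RiemMetric.laplaceBeltrami (g : RiemMetric m M) (f : M → ℝ) (p : M) : ℝ :=
  (√(g.gram p (extChartAt (𝓡 m) p p)).det)⁻¹ *
    ∑ i, ∑ j, partialDeriv i
      (fun y => √(g.gram p y).det * (g.gram p y)⁻¹ i j *
        partialDeriv j (f ∘ (extChartAt (𝓡 m) p).symm) y)
      (extChartAt (𝓡 m) p p)

/-- The group `G` acts on `M` by isometries of the Riemannian metric. -/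
def ActsByIsometries (G : Type*) [Group G] [MulAction G M] (g : RiemMetric m M) : Prop :=
  ∀ (a : G) (p : M) (v w : TangentSpace (𝓡 m) p),
    g.inner (a • p) (mfderiv (𝓡 m) (𝓡 m) (fun x : M => a • x) p v)
      (mfderiv (𝓡 m) (𝓡 m) (fun x : M => a • x) p w) = g.inner p v w

/-- The isotropy representation: for `h • o = o`, the differential at `o` of `x ↦ h • x`,
a map `T_oM → T_{h • o}M = T_oM`. -/
def isotropyMap {G : Type*} [Group G] [MulAction G M] (o : M) (h : MulAction.stabilizer G o) :
    TangentSpace (𝓡 m) o →L[ℝ] TangentSpace (𝓡 m) o :=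
  (mfderiv (𝓡 m) (𝓡 m) (fun x : M => (h : G) • x) o :
    EuclideanSpace ℝ (Fin m) →L[ℝ] EuclideanSpace ℝ (Fin m))

/-- The stabilizer of `o` has no proper nonzero invariant subspace in `T_oM`. -/
def IsotropyIrreducible (m : ℕ) {M : Type*} [TopologicalSpace M]
    [ChartedSpace (EuclideanSpace ℝ (Fin m)) M] [IsManifold (𝓡 m) ∞ M]
    (G : Type*) [Group G] [MulAction G M] (o : M) : Prop :=
  ∀ W : Submodule ℝ (TangentSpace (𝓡 m) o),
    (∀ h : MulAction.stabilizer G o, ∀ w ∈ W, isotropyMap o h w ∈ W) → W = ⊥ ∨ W = ⊤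

end RiemannianGeometry

section FunctionSpaces

variable {m : ℕ} {M : Type*} [TopologicalSpace M] [ChartedSpace (EuclideanSpace ℝ (Fin m)) M]
  [IsManifold (𝓡 m) ∞ M] [MeasurableSpace M]

/-- The subspace `E` of `L²(M)` is invariant under the translations `u ↦ u ∘ a`, `a ∈ G`. -/
def IsTranslationInvariant (G : Type*) [Group G] [MulAction G M] (μ : Measure M)
    (E : Submodule ℝ (Lp ℝ 2 μ)) : Prop :=
  ∀ a : G, ∀ u ∈ E, ∃ w ∈ E, w =ᵐ[μ] fun x => u (a • x)

/-- `Δ u = w` for `u, w` in `L²(M)`, with `u` (the class of) a smooth function. -/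
def HasLaplacian (g : RiemMetric m M) (μ : Measure M) (u w : Lp ℝ 2 μ) : Prop :=
  ∃ f : M → ℝ, ContMDiff (𝓡 m) 𝓘(ℝ, ℝ) ∞ f ∧ u =ᵐ[μ] f ∧ w =ᵐ[μ] g.laplaceBeltrami f

/-- The linear operator `D` of `E` is the restriction of `Δ` to `E`. -/
def IsLaplacianOn (g : RiemMetric m M) (μ : Measure M) (E : Submodule ℝ (Lp ℝ 2 μ))
    (D : E →ₗ[ℝ] E) : Prop :=
  ∀ u : E, HasLaplacian g μ (u : Lp ℝ 2 μ) (D u : Lp ℝ 2 μ)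

/-- `φ : M → E` is the family of vectors `φ_p ∈ E` that represent the evaluation functionals:
`⟨φ_p, u⟩ = u(p)` for all `u ∈ E`, where `u(p)` is the value at `p` of the continuous
representative of `u`. -/
def IsEvaluationMap (μ : Measure M) (E : Submodule ℝ (Lp ℝ 2 μ)) (φ : M → E) : Prop :=
  ∀ u : E, ∃ f : M → ℝ, Continuous f ∧ (u : Lp ℝ 2 μ) =ᵐ[μ] f ∧ ∀ p, inner ℝ (φ p) u = f p

/-- The map `ι : M → S`, `ι(p) = φ_p / |φ_p|`, into the unit sphere `S` of `E`. -/
def unitMap {μ : Measure M} {E : Submodule ℝ (Lp ℝ 2 μ)} (φ : M → E) (p : M) : E :=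
  ‖φ p‖⁻¹ • φ p

/-- The differential `d_pι(v)` of a map `ι` from `M` to a vector space `V`, as a vector of `V`. -/
def vecDeriv {V : Type*} [NormedAddCommGroup V] [NormedSpace ℝ V] (ι : M → V) (p : M)
    (v : TangentSpace (𝓡 m) p) : V :=
  mfderiv (𝓡 m) 𝓘(ℝ, V) ι p v

/-- `s` is the scaling factor of `ι : M → S`, `ι(p) = φ_p / |φ_p|`, where `S` is the unit sphere
of `E`: the map `ι` is well defined and smooth, `s > 0`, and `|d_pι(v)| = s |v|` for every tangent
vector `v` of `M`. The metric of `S` is induced by the Euclidean metric of `E`, so `|d_pι(v)|` may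
be computed in `E`. -/
def IsScalingFactor (g : RiemMetric m M) (μ : Measure M) (E : Submodule ℝ (Lp ℝ 2 μ))
    (s : ℝ) : Prop :=
  ∃ φ : M → E, IsEvaluationMap μ E φ ∧ (∀ p, φ p ≠ 0) ∧
    ContMDiff (𝓡 m) 𝓘(ℝ, E) ∞ (unitMap φ) ∧ 0 < s ∧
    ∀ (p : M) (v : TangentSpace (𝓡 m) p),
      ‖vecDeriv (unitMap φ) p v‖ = s * g.tangentNorm p v

/-- `E` is the orthogonal sum of the nonzero `G`-invariant subspaces `F j`, and `Δ u = -λ_j u` for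
`u ∈ F j`. The numbers `λ_j` need not be distinct. -/
structure IsEigenDecomposition (G : Type*) [Group G] [MulAction G M] (g : RiemMetric m M)
    (μ : Measure M) (E : Submodule ℝ (Lp ℝ 2 μ)) {l : ℕ} (F : Fin l → Submodule ℝ (Lp ℝ 2 μ))
    (lam : Fin l → ℝ) : Prop where
  ne_bot : ∀ j, F j ≠ ⊥
  invariant : ∀ j, IsTranslationInvariant G μ (F j)
  orthogonal : Pairwise fun i j => F i ⟂ F j
  iSup_eq : ⨆ j, F j = E
  eigen : ∀ j, ∀ u ∈ F j, HasLaplacian g μ u (-lam j • u)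

end FunctionSpaces

end

/-! The group `G` acts on the function space `E` orthogonally by translations `ρ`, and the
evaluation map satisfies `φ (a • x) = ρ a (φ x)`. So `‖φ‖` is constant, and the trace formula Tr T =
∫ ⟨φ_x, T φ_x⟩ with T = 1 gives ‖φ‖² = dim E. The form ⟨dφ v, dφ w⟩ on tangent vectors is invariant,
so by Schur's lemma at the base point it equals c · g (`exists_homothety`). If c were 0, φ would be
constant, which is impossible for a nonzero space orthogonal to the constants. Normalising φ gives
s² = c / dim E.

To find c, take a basis A_a of the space of infinitesimal operators of ρ, orthonormal for the form
-Tr(ST). The fields X_a with dφ(X_a) = A_a φ are Killing fields. The form ∑ g(X_a, ·) g(X_a, ·) is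
again invariant, hence a multiple of g, and rescaling makes it g itself (`exists_killing_frame`);
then ∑ X_a ⊗ X_a is the inverse metric. Killing fields are divergence free, so Δ = ∑ X_a²
(`laplacian_of_killing_frame`). On the functions ⟨φ, u⟩ this says Δ⟨φ, u⟩ = ⟨φ, C u⟩ with C = ∑
A_a², a symmetric operator commuting with ρ. Thus Δ preserves E, and the eigenspaces of C decompose
it. Moreover ⟨φ, C φ⟩ = -∑ ‖A_a φ‖² = -c ∑ g(X_a, X_a) = -c m, so the trace formula gives Tr Δ = -c
m.

For an orthogonal decomposition of E the evaluation vectors add up, hence so do the constants: c = ∑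
c_j with c_j = s_j² dim E^j. This is the weighted sum formula.

Regularity: φ is at first only defined almost everywhere. Fubini yields an equivariant continuous
version (`exists_equivariant_evaluation`). It is smooth because continuous representations are
smooth (`contMDiff_of_continuous_monoidHom`) and the orbit maps are submersions
(`surjective_mfderiv_orbit`). -/

section LinearAlgebra

/-! ### Invariant bilinear forms and orthonormal frames. -/

variable {V : Type*} [AddCommGroup V] [Module ℝ V]

/-- The inner product structure given by a positive definite symmetric bilinear form. -/
@[reducible] noncomputable def coreOfPosDef (B : V →ₗ[ℝ] V →ₗ[ℝ] ℝ)
    (hsymm : ∀ v w, B v w = B w v) (hpos : ∀ v, v ≠ 0 → 0 < B v v) :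
    InnerProductSpace.Core ℝ V where
  inner v w := B v w
  conj_inner_symm v w := hsymm w v
  re_inner_nonneg v := by
    rcases eq_or_ne v 0 with rfl | hv
    · simp
    · exact (hpos v hv).le
  add_left := by simp
  smul_left := by simp
  definite v h := by
    by_contra hv
    exact (hpos v hv).ne' h

/-- Schur's lemma for invariant symmetric bilinear forms. -/
theorem eq_smul_of_irreducible [FiniteDimensional ℝ V] (B q : V →ₗ[ℝ] V →ₗ[ℝ] ℝ)
    (hsymm : ∀ v w, B v w = B w v) (hpos : ∀ v, v ≠ 0 → 0 < B v v)
    (hq : ∀ v w, q v w = q w v) {ι : Type*} (T : ι → V →ₗ[ℝ] V)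
    (hTB : ∀ i v w, B (T i v) (T i w) = B v w) (hTq : ∀ i v w, q (T i v) (T i w) = q v w)
    (hirr : ∀ W : Submodule ℝ V, (∀ i, ∀ w ∈ W, T i w ∈ W) → W = ⊥ ∨ W = ⊤) :
    ∃ c : ℝ, ∀ v w, q v w = c * B v w := by
  rcases subsingleton_or_nontrivial V with hV | hV
  · exact ⟨0, fun v w => by rw [Subsingleton.elim v 0]; simp⟩
  -- The spectral theorem, applied to the operator that represents `q` with respect to `B`, provides
  -- one eigenvector.
  obtain ⟨c, x, hx0, hx⟩ : ∃ (c : ℝ) (x : V), x ≠ 0 ∧ ∀ w, q x w = c * B x w := by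
    let core := coreOfPosDef B hsymm hpos
    let : NormedAddCommGroup V := core.toNormedAddCommGroup
    let : InnerProductSpace ℝ V := InnerProductSpace.ofCore core.toCore
    have hB : ∀ v w, inner ℝ v w = B v w := fun _ _ => rfl
    let S : V →ₗ[ℝ] V :=
      { toFun := fun v => (InnerProductSpace.toDual ℝ V).symm (LinearMap.toContinuousLinearMap (q v))
        map_add' := by intro v w; simp
        map_smul' := by intro r v; simp }
    have hS : ∀ v w, inner ℝ (S v) w = q v w := by
      intro v w
      simp [S, InnerProductSpace.toDual_symm_apply]
    have hSs : S.IsSymmetric := by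
      intro v w
      rw [hS, real_inner_comm, hS, hq]
    let i : Fin (Module.finrank ℝ V) := ⟨0, Module.finrank_pos⟩
    refine ⟨hSs.eigenvalues rfl i, hSs.eigenvectorBasis rfl i, ?_, fun w => ?_⟩
    · exact (hSs.eigenvectorBasis rfl).orthonormal.ne_zero i
    · rw [← hS, hSs.apply_eigenvectorBasis, ← hB, inner_smul_left]
      simp
  refine ⟨c, ?_⟩
  -- The eigenspace for `c`, written as the radical of `q - c • B`; it is invariant and contains
  -- `x`.
  let W : Submodule ℝ V := LinearMap.ker (q - c • B)
  have hW : ∀ v, v ∈ W ↔ ∀ w, q v w = c * B v w := by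
    intro v
    simp only [W, LinearMap.mem_ker, LinearMap.ext_iff, LinearMap.sub_apply, LinearMap.smul_apply,
      smul_eq_mul, sub_eq_zero]
  have htop : W = ⊤ := by
    refine (hirr W fun i v hv => ?_).resolve_left ?_
    -- Preserving the definite form `B` makes `T i` bijective, so every test vector has the form `T
    -- i w`.
    · have hinj : Function.Injective (T i) := by
        rw [injective_iff_map_eq_zero]
        intro v hv
        by_contra hv0
        have := hpos v hv0
        rw [← hTB i, hv] at this
        simp at this
      have hsurj := LinearMap.injective_iff_surjective.1 hinj
      rw [hW] at hv ⊢
      intro w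
      obtain ⟨w, rfl⟩ := hsurj w
      rw [hTq, hTB, hv]
    · exact fun h => hx0 (by rw [← Submodule.mem_bot ℝ, ← h, hW]; exact hx)
  exact fun v => (hW v).1 (htop ▸ Submodule.mem_top)

/-- An orthonormal basis for a positive definite form: a spanning family whose symmetric square is
invariant under all isometries of the form. -/
theorem exists_invariant_frame [FiniteDimensional ℝ V] (B : V →ₗ[ℝ] V →ₗ[ℝ] ℝ)
    (hsymm : ∀ v w, B v w = B w v) (hpos : ∀ v, v ≠ 0 → 0 < B v v) :
    ∃ (d : ℕ) (e : Fin d → V), Submodule.span ℝ (Set.range e) = ⊤ ∧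
      ∀ T : V →ₗ[ℝ] V, (∀ v w, B (T v) (T w) = B v w) → ∀ β : V →ₗ[ℝ] V →ₗ[ℝ] ℝ,
        ∑ i, β (T (e i)) (T (e i)) = ∑ i, β (e i) (e i) := by
  let core := coreOfPosDef B hsymm hpos
  let : NormedAddCommGroup V := core.toNormedAddCommGroup
  let : InnerProductSpace ℝ V := InnerProductSpace.ofCore core.toCore
  let e := stdOrthonormalBasis ℝ V
  refine ⟨_, e, by simpa using e.toBasis.span_eq, fun T hT β => ?_⟩
  -- `T` carries the orthonormal basis `e` to another one `f`, and `∑ f i ⊗ f i = ∑ e i ⊗ e i`.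
  let T' : V →ₗᵢ[ℝ] V := T.isometryOfInner hT
  let T'' : V ≃ₗᵢ[ℝ] V := T'.toLinearIsometryEquiv rfl
  let f := e.map T''
  have hf : ∀ i, T (e i) = f i := fun i => by simp [f, T'', T']
  calc ∑ i, β (T (e i)) (T (e i)) = ∑ i, ∑ j, ∑ k, inner ℝ (e j) (f i) * inner ℝ (e k) (f i) *
        β (e j) (e k) := by
        refine Finset.sum_congr rfl fun i _ => ?_
        rw [hf]
        conv_lhs => rw [← e.sum_repr' (f i)]
        simp only [map_sum, map_smul, LinearMap.sum_apply, LinearMap.smul_apply, smul_eq_mul,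
          Finset.mul_sum]
        rw [Finset.sum_comm]
        refine Finset.sum_congr rfl fun j _ => Finset.sum_congr rfl fun k _ => ?_
        ring
    _ = ∑ j, ∑ k, (∑ i, inner ℝ (e j) (f i) * inner ℝ (f i) (e k)) * β (e j) (e k) := by
        rw [Finset.sum_comm]
        refine Finset.sum_congr rfl fun j _ => ?_
        rw [Finset.sum_comm]
        refine Finset.sum_congr rfl fun k _ => ?_
        rw [Finset.sum_mul]
        refine Finset.sum_congr rfl fun i _ => ?_
        rw [real_inner_comm (e k)]
    _ = ∑ i, β (e i) (e i) := by
        refine Finset.sum_congr rfl fun j _ => ?_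
        simp only [f.sum_inner_mul_inner]
        simp [orthonormal_iff_ite.1 e.orthonormal]

end LinearAlgebra

/-! ### Differentiation of determinants and inverse matrices. -/

section Jacobi

variable {n : Type*} [Fintype n] [DecidableEq n]

/-- Jacobi's formula. Differentiating the Leibniz expansion replaces one column at a time by that of
`M'`; by Cramer's rule the resulting determinants are the diagonal entries of the adjugate times
`M'`. -/
theorem hasDerivAt_det {M : ℝ → Matrix n n ℝ} {M' : Matrix n n ℝ} {t : ℝ}
    (hM : ∀ i j, HasDerivAt (fun s => M s i j) (M' i j) t) :
    HasDerivAt (fun s => (M s).det) ((M t).adjugate * M').trace t := by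
  have h : HasDerivAt (fun s => (M s).det) (∑ σ : Equiv.Perm n, (Equiv.Perm.sign σ : ℝ) *
      ∑ i, (∏ j ∈ Finset.univ.erase i, M t (σ j) j) * M' (σ i) i) t := by
    simp only [Matrix.det_apply']
    refine HasDerivAt.fun_sum fun σ _ => HasDerivAt.const_mul _ ?_
    simpa using HasDerivAt.fun_finsetProd (u := Finset.univ) (fun i _ => hM (σ i) i)
  convert h using 1
  have hc : ∀ i, ((M t).adjugate * M') i i = ((M t).updateCol i (fun k => M' k i)).det := by
    intro i
    rw [← Matrix.cramer_apply, Matrix.cramer_eq_adjugate_mulVec]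
    rfl
  simp only [Matrix.trace, Matrix.diag_apply, hc, Matrix.det_apply', Finset.mul_sum]
  rw [Finset.sum_comm]
  refine Finset.sum_congr rfl fun σ _ => Finset.sum_congr rfl fun i _ => ?_
  rw [← Finset.prod_erase_mul _ _ (Finset.mem_univ i), Matrix.updateCol_self]
  congr 2
  refine Finset.prod_congr rfl fun j hj => ?_
  rw [Matrix.updateCol_ne (Finset.ne_of_mem_erase hj)]

variable {F : Type*} [NormedAddCommGroup F] [NormedSpace ℝ F]

theorem differentiableAt_det {M : F → Matrix n n ℝ} {y : F}
    (hM : ∀ i j, DifferentiableAt ℝ (fun z => M z i j) y) :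
    DifferentiableAt ℝ (fun z => (M z).det) y := by
  simp only [Matrix.det_apply']
  refine DifferentiableAt.fun_sum fun σ _ => DifferentiableAt.const_mul ?_ _
  fun_prop (disch := assumption)

theorem differentiableAt_inv_apply {M : F → Matrix n n ℝ} {y : F}
    (hM : ∀ i j, DifferentiableAt ℝ (fun z => M z i j) y) (hdet : (M y).det ≠ 0) (i j : n) :
    DifferentiableAt ℝ (fun z => (M z)⁻¹ i j) y := by
  simp only [Matrix.inv_def, Matrix.smul_apply, Ring.inverse_eq_inv', Matrix.adjugate_apply,
    smul_eq_mul]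
  refine DifferentiableAt.mul ((differentiableAt_det hM).inv hdet) (differentiableAt_det ?_)
  intro a b
  by_cases h : a = j
  · subst h; simp
  · simpa [h] using hM a b

end Jacobi

/-! ### Killing fields and the Laplacian in coordinates. -/

section LaplacianOfImmersion

variable {m : ℕ} {V : Type*} [NormedAddCommGroup V] [InnerProductSpace ℝ V]

/-- A vector field induced by a skew-symmetric map is divergence free. -/
theorem fderiv_sqrt_det_of_killing {Ψ : EuclideanSpace ℝ (Fin m) → V}
    {y₀ : EuclideanSpace ℝ (Fin m)} (hΨ : ContDiffAt ℝ ∞ Ψ y₀)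
    {P : EuclideanSpace ℝ (Fin m) → Matrix (Fin m) (Fin m) ℝ} {c : ℝ} (hc : c ≠ 0)
    (hP : ∀ᶠ y in nhds y₀, ∀ i j, c * P y i j =
      inner ℝ (fderiv ℝ Ψ y (EuclideanSpace.single i 1)) (fderiv ℝ Ψ y (EuclideanSpace.single j 1)))
    (hPd : ∀ i j, DifferentiableAt ℝ (fun y => P y i j) y₀) (hdet : 0 < (P y₀).det)
    {A : V →L[ℝ] V} (hA : ∀ v w, inner ℝ (A v) w = - inner ℝ v (A w))
    {X : EuclideanSpace ℝ (Fin m) → EuclideanSpace ℝ (Fin m)} (hX : DifferentiableAt ℝ X y₀)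
    (hAX : ∀ᶠ y in nhds y₀, fderiv ℝ Ψ y (X y) = A (Ψ y)) :
    fderiv ℝ (fun y => √(P y).det) y₀ (X y₀) =
      - √(P y₀).det * ∑ i, fderiv ℝ X y₀ (EuclideanSpace.single i 1) i := by
  set e : Fin m → EuclideanSpace ℝ (Fin m) := fun i => EuclideanSpace.single i 1 with he
  set x := X y₀ with hx
  set L := fderiv ℝ Ψ y₀ with hL
  set H := fderiv ℝ (fderiv ℝ Ψ) y₀ with hH
  have hΨd : DifferentiableAt ℝ (fderiv ℝ Ψ) y₀ :=
    (hΨ.fderiv_right (m := 1) (one_add_one_eq_two.le.trans ENat.LEInfty.out)).differentiableAt (by simp)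
  have hHsymm : ∀ v w, H v w = H w v := fun v w =>
    (hΨ.isSymmSndFDerivAt (by simpa using ENat.LEInfty.out)) v w
  -- The identity `dΨ(X) = A Ψ` differentiated in the direction `v`.
  have hkill : ∀ v, H v x + L (fderiv ℝ X y₀ v) = A (L v) := by
    intro v
    have h1 : HasFDerivAt (fun y => fderiv ℝ Ψ y (X y)) _ y₀ :=
      hΨd.hasFDerivAt.clm_apply hX.hasFDerivAt
    have h2 : HasFDerivAt (fun y => A (Ψ y)) _ y₀ :=
      A.hasFDerivAt.comp y₀ (hΨ.differentiableAt (by simp)).hasFDerivAt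
    have h3 := h1.unique (h2.congr_of_eventuallyEq hAX)
    have h4 := congrArg (fun T => T v) h3
    simpa [add_comm] using h4
  have hPy := hP.self_of_nhds
  set Q : Matrix (Fin m) (Fin m) ℝ := Matrix.of fun i j => fderiv ℝ (fun y => P y i j) y₀ x with hQ
  have hQ1 : ∀ i j, c * Q i j = inner ℝ (L (e i)) (H x (e j)) + inner ℝ (H x (e i)) (L (e j)) := by
    intro i j
    have h1 : HasFDerivAt (fun y => inner ℝ (fderiv ℝ Ψ y (e i)) (fderiv ℝ Ψ y (e j))) _ y₀ :=
      (hΨd.hasFDerivAt.clm_apply (hasFDerivAt_const (e i) y₀)).inner ℝ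
        (hΨd.hasFDerivAt.clm_apply (hasFDerivAt_const (e j) y₀))
    have h2 : HasFDerivAt (fun y => c * P y i j) _ y₀ := (hPd i j).hasFDerivAt.const_mul c
    have h3 := h2.unique (h1.congr_of_eventuallyEq (hP.mono fun y hy => hy i j))
    have h4 := congrArg (fun T => T x) h3
    simpa [hQ, he] using h4
  have hexp : ∀ v w, inner ℝ (L v) (L w) = c * ∑ k, ∑ l, v k * w l * P y₀ k l := by
    intro v w
    have hv : ∀ v : EuclideanSpace ℝ (Fin m), v = ∑ k, v k • e k := fun v => by
      simpa [he] using ((EuclideanSpace.basisFun (Fin m) ℝ).sum_repr v).symm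
    conv_lhs => rw [hv v, hv w]
    simp only [map_sum, map_smul, sum_inner, inner_sum, inner_smul_left, inner_smul_right,
      Finset.mul_sum]
    rw [Finset.sum_comm]
    refine Finset.sum_congr rfl fun k _ => Finset.sum_congr rfl fun l _ => ?_
    rw [conj_trivial]
    linear_combination v k * w l * (hPy k l).symm
  set D : Matrix (Fin m) (Fin m) ℝ := Matrix.of fun i j => fderiv ℝ X y₀ (e j) i with hD
  have hPsymm : (P y₀)ᵀ = P y₀ := by
    ext i j
    have := (hPy j i).trans ((real_inner_comm _ _).trans (hPy i j).symm)
    exact mul_left_cancel₀ hc this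
  -- The Killing equation: skewness of `A` cancels its two contributions to the derivative `Q` of
  -- the metric along `X`, leaving the Jacobian `D` of `X`.
  have hQ2 : Q = - (P y₀ * D + Dᵀ * P y₀) := by
    ext i j
    apply mul_left_cancel₀ hc
    have h1 : ∀ i j, inner ℝ (H x (e i)) (L (e j)) = inner ℝ (A (L (e i))) (L (e j))
        - c * (Dᵀ * P y₀) i j := by
      intro i j
      rw [hHsymm, ← hkill, inner_add_left, hexp, Matrix.mul_apply]
      simp [he, hD]
    rw [hQ1, h1, real_inner_comm, h1, hA]
    have h2 : (Dᵀ * P y₀) j i = (P y₀ * D) i j := by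
      rw [← Matrix.transpose_apply (P y₀ * D), Matrix.transpose_mul, hPsymm]
    rw [h2, real_inner_comm (L (e j)) (A (L (e i))), Matrix.neg_apply, Matrix.add_apply]
    ring
  have hder : HasDerivAt (fun t : ℝ => (P (y₀ + t • x)).det) (((P y₀).adjugate * Q).trace) 0 := by
    have := hasDerivAt_det (M := fun t : ℝ => P (y₀ + t • x)) (M' := Q) (t := 0) (fun i j => by
      have hl : HasDerivAt (fun t : ℝ => y₀ + t • x) x 0 := by
        simpa using ((hasDerivAt_id (0 : ℝ)).smul_const x).const_add y₀
      have h0 : HasFDerivAt (fun y => P y i j) (fderiv ℝ (fun y => P y i j) y₀) (y₀ + (0:ℝ) • x) := by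
        simpa using (hPd i j).hasFDerivAt
      exact h0.comp_hasDerivAt (0 : ℝ) hl)
    simpa using this
  have hder2 : fderiv ℝ (fun y => (P y).det) y₀ x = ((P y₀).adjugate * Q).trace := by
    have hl : HasDerivAt (fun t : ℝ => y₀ + t • x) x 0 := by
      simpa using ((hasDerivAt_id (0 : ℝ)).smul_const x).const_add y₀
    have h0 : HasFDerivAt (fun y => (P y).det) (fderiv ℝ (fun y => (P y).det) y₀)
        (y₀ + (0:ℝ) • x) := by
      simpa using (differentiableAt_det hPd).hasFDerivAt
    have h1 := h0.comp_hasDerivAt (0 : ℝ) hl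
    exact h1.unique (show HasDerivAt ((fun y => (P y).det) ∘ fun t : ℝ => y₀ + t • x) _ _ from hder)
  -- Both summands of `Q` contribute `det P * tr D`; the factor 2 is later absorbed by
  -- differentiating the square root.
  have htr : ((P y₀).adjugate * Q).trace = - 2 * (P y₀).det * D.trace := by
    rw [hQ2, Matrix.mul_neg, Matrix.mul_add, Matrix.trace_neg, Matrix.trace_add, ← Matrix.mul_assoc,
      Matrix.adjugate_mul, ← Matrix.mul_assoc, Matrix.trace_mul_comm ((P y₀).adjugate * Dᵀ),
      ← Matrix.mul_assoc, Matrix.mul_adjugate]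
    simp
    ring
  rw [((differentiableAt_det hPd).hasFDerivAt.sqrt hdet.ne').fderiv]
  have hs := Real.mul_self_sqrt hdet.le
  have hs0 := (Real.sqrt_pos.2 hdet).ne'
  simp only [_root_.smul_apply, hder2, htr, smul_eq_mul]
  have : D.trace = ∑ i, fderiv ℝ X y₀ (e i) i := rfl
  rw [← this]
  field_simp
  rw [Real.sq_sqrt hdet.le]

end LaplacianOfImmersion

section LaplacianOfImmersion

variable {m : ℕ} {V : Type*} [NormedAddCommGroup V] [InnerProductSpace ℝ V]

/-- The Laplacian of the linear functionals on a submanifold of `V` whose metric is, up to the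
factor `c`, induced from `V`, and dual to a family of vector fields induced by skew-symmetric
maps. -/
theorem laplacian_of_killing_frame {Ψ : EuclideanSpace ℝ (Fin m) → V}
    {U : Set (EuclideanSpace ℝ (Fin m))} (hU : IsOpen U) {y₀ : EuclideanSpace ℝ (Fin m)}
    (hy₀ : y₀ ∈ U) (hΨ : ContDiffOn ℝ ∞ Ψ U)
    {P : EuclideanSpace ℝ (Fin m) → Matrix (Fin m) (Fin m) ℝ} {c : ℝ} (hc : c ≠ 0)
    (hP : ∀ y ∈ U, ∀ i j, c * P y i j =
      inner ℝ (fderiv ℝ Ψ y (EuclideanSpace.single i 1)) (fderiv ℝ Ψ y (EuclideanSpace.single j 1)))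
    (hdet : ∀ y ∈ U, 0 < (P y).det)
    {d : ℕ} {A : Fin d → V →L[ℝ] V} (hA : ∀ a v w, inner ℝ (A a v) w = - inner ℝ v (A a w))
    (htan : ∀ a, ∀ y ∈ U, ∃ x, fderiv ℝ Ψ y x = A a (Ψ y))
    (hframe : ∀ y ∈ U, ∀ v w, ∑ a, inner ℝ (A a (Ψ y)) (fderiv ℝ Ψ y v) *
      inner ℝ (A a (Ψ y)) (fderiv ℝ Ψ y w) = c * inner ℝ (fderiv ℝ Ψ y v) (fderiv ℝ Ψ y w)) (u : V) :
    (√(P y₀).det)⁻¹ * ∑ i, ∑ j, partialDeriv i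
      (fun y => √(P y).det * (P y)⁻¹ i j * partialDeriv j (fun z => inner ℝ (Ψ z) u) y) y₀ =
      ∑ a, inner ℝ (A a (A a (Ψ y₀))) u := by
  set e : Fin m → EuclideanSpace ℝ (Fin m) := fun i => EuclideanSpace.single i 1 with he
  have hv : ∀ v : EuclideanSpace ℝ (Fin m), v = ∑ k, v k • e k := fun v => by
    simpa [he] using ((EuclideanSpace.basisFun (Fin m) ℝ).sum_repr v).symm
  have hUn : ∀ᶠ y in nhds y₀, y ∈ U := hU.mem_nhds hy₀
  have hΨat : ∀ y ∈ U, ContDiffAt ℝ ∞ Ψ y := fun y hy => hΨ.contDiffAt (hU.mem_nhds hy)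
  have hΨ1 : ∀ y ∈ U, DifferentiableAt ℝ Ψ y := fun y hy => (hΨat y hy).differentiableAt (by simp)
  have hΨd : DifferentiableAt ℝ (fderiv ℝ Ψ) y₀ :=
    ((hΨat y₀ hy₀).fderiv_right (m := 1)
      (one_add_one_eq_two.le.trans ENat.LEInfty.out)).differentiableAt (by simp)
  have hPe : ∀ i j, (fun y => P y i j) =ᶠ[nhds y₀]
      fun y => c⁻¹ * inner ℝ (fderiv ℝ Ψ y (e i)) (fderiv ℝ Ψ y (e j)) := fun i j => by
    filter_upwards [hUn] with y hy
    rw [← hP y hy i j, inv_mul_cancel_left₀ hc]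
  have hcol : ∀ i, DifferentiableAt ℝ (fun y => fderiv ℝ Ψ y (e i)) y₀ := fun i =>
    hΨd.clm_apply (differentiableAt_const _)
  have hPd : ∀ i j, DifferentiableAt ℝ (fun y => P y i j) y₀ := fun i j =>
    (((hcol i).inner ℝ (hcol j)).const_mul _).congr_of_eventuallyEq (hPe i j)
  have hsqrtd : DifferentiableAt ℝ (fun y => √(P y).det) y₀ :=
    (differentiableAt_det hPd).sqrt (hdet y₀ hy₀).ne'
  have hinvd : ∀ i j, DifferentiableAt ℝ (fun y => (P y)⁻¹ i j) y₀ :=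
    differentiableAt_inv_apply hPd (hdet y₀ hy₀).ne'
  -- the vector fields
  let h : Fin d → EuclideanSpace ℝ (Fin m) → Fin m → ℝ :=
    fun a y j => c⁻¹ * inner ℝ (A a (Ψ y)) (fderiv ℝ Ψ y (e j))
  let X : Fin d → EuclideanSpace ℝ (Fin m) → EuclideanSpace ℝ (Fin m) :=
    fun a y => WithLp.toLp 2 ((P y)⁻¹ *ᵥ h a y)
  have hunit : ∀ y ∈ U, IsUnit (P y).det := fun y hy => (hdet y hy).ne'.isUnit
  have hXeq : ∀ a, ∀ y ∈ U, fderiv ℝ Ψ y (X a y) = A a (Ψ y) := by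
    intro a y hy
    obtain ⟨x, hx⟩ := htan a y hy
    have hh : h a y = P y *ᵥ x.ofLp := by
      ext j
      simp only [h, Matrix.mulVec, dotProduct]
      rw [← hx]
      conv_lhs => rw [hv x]
      simp only [map_sum, map_smul, sum_inner, inner_smul_left, Finset.mul_sum]
      refine Finset.sum_congr rfl fun k _ => ?_
      rw [real_inner_comm, ← hP y hy j k, conj_trivial]
      field_simp
    have : X a y = x := by
      simp only [X]
      rw [hh, Matrix.mulVec_mulVec, Matrix.nonsing_inv_mul _ (hunit y hy), Matrix.one_mulVec]
    rw [this, hx]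
  have hXd : ∀ a i, DifferentiableAt ℝ (fun y => X a y i) y₀ := by
    intro a i
    simp only [X, Matrix.mulVec, dotProduct, h]
    refine DifferentiableAt.fun_sum fun j _ => (hinvd i j).mul (DifferentiableAt.const_mul ?_ _)
    exact ((A a).differentiableAt.comp y₀ (hΨ1 y₀ hy₀)).inner ℝ (hcol j)
  have hXd' : ∀ a, DifferentiableAt ℝ (X a) y₀ := fun a => differentiableAt_euclidean.2 (hXd a)
  have hinv : ∀ y ∈ U, ∀ i j, (P y)⁻¹ i j = ∑ a, X a y i * X a y j := by
    intro y hy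
    -- The frame condition says `K Kᵀ = P` for the covariant components, so the contravariant ones
    -- `P⁻¹ K` factor `P⁻¹`.
    let K : Matrix (Fin m) (Fin d) ℝ := Matrix.of fun j a => h a y j
    have hK : K * Kᵀ = P y := by
      ext i j
      simp only [Matrix.mul_apply, K, Matrix.transpose_apply, Matrix.of_apply, h]
      have := hframe y hy (e i) (e j)
      rw [← hP y hy i j] at this
      have h2 : P y i j = c⁻¹ * c⁻¹ * (c * (c * P y i j)) := by field_simp
      rw [h2, ← this, Finset.mul_sum]
      refine Finset.sum_congr rfl fun a _ => by ring
    have hsymm : (P y)⁻¹ᵀ = (P y)⁻¹ := by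
      rw [Matrix.transpose_nonsing_inv, ← hK, Matrix.transpose_mul, Matrix.transpose_transpose]
    have : (P y)⁻¹ = ((P y)⁻¹ * K) * ((P y)⁻¹ * K)ᵀ := by
      rw [Matrix.transpose_mul, hsymm, ← Matrix.mul_assoc, Matrix.mul_assoc _ K, hK,
        Matrix.nonsing_inv_mul _ (hunit y hy), Matrix.one_mul]
    intro i j
    conv_lhs => rw [this]
    rw [Matrix.mul_apply]
    rfl
  have hpd : ∀ j, ∀ y ∈ U, partialDeriv j (fun z => inner ℝ (Ψ z) u) y =
      inner ℝ (fderiv ℝ Ψ y (e j)) u := by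
    intro j y hy
    have := (hΨ1 y hy).hasFDerivAt.inner ℝ (hasFDerivAt_const u y)
    rw [partialDeriv, this.fderiv]
    simp [he]
  have hfd : ∀ i j, DifferentiableAt ℝ (fun y => √(P y).det * (P y)⁻¹ i j *
      partialDeriv j (fun z => inner ℝ (Ψ z) u) y) y₀ := by
    intro i j
    refine (hsqrtd.mul (hinvd i j)).mul ?_
    refine ((hcol j).inner ℝ (differentiableAt_const u)).congr_of_eventuallyEq ?_
    filter_upwards [hUn] with y hy using hpd j y hy
  -- Inserting `P⁻¹ = ∑ X_a X_aᵀ` writes the gradient of `⟨Ψ, u⟩` as the sum of the `X_a`, each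
  -- weighted by the derivative `⟨A_a Ψ, u⟩` along it.
  have hsum : ∀ i, ∑ j, partialDeriv i (fun y => √(P y).det * (P y)⁻¹ i j *
      partialDeriv j (fun z => inner ℝ (Ψ z) u) y) y₀ =
      ∑ a, fderiv ℝ (fun y => √(P y).det * X a y i * inner ℝ (A a (Ψ y)) u) y₀ (e i) := by
    intro i
    simp only [partialDeriv] at hfd ⊢
    rw [← _root_.sum_apply, ← fderiv_fun_sum fun j _ => hfd i j,
      ← _root_.sum_apply, ← fderiv_fun_sum]
    · congr 1
      apply Filter.EventuallyEq.fderiv_eq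
      filter_upwards [hUn] with y hy
      have hAe : ∀ a, inner ℝ (A a (Ψ y)) u = ∑ j, X a y j * inner ℝ (fderiv ℝ Ψ y (e j)) u := by
        intro a
        rw [← hXeq a y hy]
        conv_lhs => rw [hv (X a y)]
        simp [sum_inner, inner_smul_left]
      have hpd' := fun j => hpd j y hy
      simp only [partialDeriv] at hpd'
      simp only [hpd', hinv y hy, hAe, Finset.mul_sum, Finset.sum_mul]
      rw [Finset.sum_comm]
      refine Finset.sum_congr rfl fun a _ => Finset.sum_congr rfl fun j _ => by ring
    · intro a _
      exact (hsqrtd.mul (hXd a i)).mul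
        (((A a).differentiableAt.comp y₀ (hΨ1 y₀ hy₀)).inner ℝ (differentiableAt_const u))
  simp only [hsum]
  rw [Finset.sum_comm, Finset.mul_sum]
  refine Finset.sum_congr rfl fun a _ => ?_
  -- Since `√det P • X_a` has zero coordinate divergence, only the derivative of `⟨A_a Ψ, u⟩` along
  -- `X_a` survives, which is `⟨A_a A_a Ψ, u⟩`.
  have hkill := fderiv_sqrt_det_of_killing (hΨat y₀ hy₀) hc
    (hUn.mono fun y hy => hP y hy) hPd (hdet y₀ hy₀) (hA a) (hXd' a) (hUn.mono (hXeq a))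
  have hterm : ∀ i, fderiv ℝ (fun y => √(P y).det * X a y i * inner ℝ (A a (Ψ y)) u) y₀ (e i) =
      √(P y₀).det * X a y₀ i * inner ℝ (A a (fderiv ℝ Ψ y₀ (e i))) u +
      (√(P y₀).det * fderiv ℝ (X a) y₀ (e i) i +
        fderiv ℝ (fun y => √(P y).det) y₀ (e i) * X a y₀ i) * inner ℝ (A a (Ψ y₀)) u := by
    intro i
    have h1 := (hsqrtd.hasFDerivAt.mul
      (hasFDerivWithinAt_univ.1 (hasFDerivWithinAt_euclidean.1
        (hasFDerivWithinAt_univ.2 (hXd' a).hasFDerivAt) i))).mul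
      (((A a).hasFDerivAt.comp y₀ (hΨ1 y₀ hy₀).hasFDerivAt).inner ℝ (hasFDerivAt_const u y₀))
    have h2 := h1.fderiv
    simp only [Function.comp_def] at h2
    refine (congrArg (fun T => T (e i)) h2).trans ?_
    simp
    ring
  simp only [hterm, Finset.sum_add_distrib, ← Finset.sum_mul]
  have hs1 : ∑ i, √(P y₀).det * X a y₀ i * inner ℝ (A a (fderiv ℝ Ψ y₀ (e i))) u =
      √(P y₀).det * inner ℝ (A a (A a (Ψ y₀))) u := by
    rw [← hXeq a y₀ hy₀]
    conv_rhs => rw [hv (X a y₀)]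
    simp only [map_sum, map_smul, sum_inner, inner_smul_left, Finset.mul_sum, conj_trivial,
      mul_assoc]
  have hs2 : ∑ i, fderiv ℝ (fun y => √(P y).det) y₀ (e i) * X a y₀ i =
      fderiv ℝ (fun y => √(P y).det) y₀ (X a y₀) := by
    conv_rhs => rw [hv (X a y₀)]
    simp only [map_sum, map_smul, smul_eq_mul]
    exact Finset.sum_congr rfl fun i _ => mul_comm _ _
  rw [hs1, hs2, hkill, ← Finset.mul_sum]
  have hs0 := (Real.sqrt_pos.2 (hdet y₀ hy₀)).ne'
  have : √(P y₀).det * ∑ i, fderiv ℝ (X a) y₀ (e i) i +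
      -√(P y₀).det * ∑ i, fderiv ℝ (X a) y₀ (EuclideanSpace.single i 1) i = 0 := by
    simp [he]
  rw [this, zero_mul, add_zero, inv_mul_cancel_left₀ hs0]

end LaplacianOfImmersion

/-! ### Smoothness of continuous representations. -/

section SmoothRepresentation

variable {k : ℕ} {G : Type*} [TopologicalSpace G] [CompactSpace G]
    [ChartedSpace (EuclideanSpace ℝ (Fin k)) G] {R : Type*} [NormedRing R] [NormedAlgebra ℝ R]

/-- Integrals depending smoothly on a parameter, for an integrand that is supported in a chart. -/
theorem contDiffAt_integral_of_tsupport_subset [MeasurableSpace G] [BorelSpace G]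
    (ν : Measure G) [IsFiniteMeasure ν] {f : G → R} (hf : Continuous f)
    {K : EuclideanSpace ℝ (Fin k) → G → ℝ} {s : Set (EuclideanSpace ℝ (Fin k))} (hs : IsOpen s)
    {x₀ : EuclideanSpace ℝ (Fin k)} (hx₀ : x₀ ∈ s) (g₀ : G) {C : Set G} (hC : IsCompact C)
    (hCs : C ⊆ (extChartAt (𝓡 k) g₀).source) (hK0 : ∀ x ∈ s, ∀ a, a ∉ C → K x a = 0)
    (hK : ContDiffOn ℝ ∞ (fun q : EuclideanSpace ℝ (Fin k) × EuclideanSpace ℝ (Fin k) =>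
      K q.1 ((extChartAt (𝓡 k) g₀).symm q.2)) (s ×ˢ (extChartAt (𝓡 k) g₀).target)) :
    ContDiffAt ℝ ∞ (fun x => ∫ a, K x a • f a ∂ν) x₀ := by
  set e := extChartAt (𝓡 k) g₀ with he
  have hTo : IsOpen e.target := isOpen_extChartAt_target g₀
  have hSo : IsOpen e.source := isOpen_extChartAt_source g₀
  have hec : ContinuousOn e e.source := continuousOn_extChartAt g₀
  have hesc : ContinuousOn e.symm e.target := continuousOn_extChartAt_symm g₀
  have hem : AEMeasurable e (ν.restrict e.source) := hec.aemeasurable hSo.measurableSet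
  -- Pushing the measure forward to the chart makes the integral Euclidean, where it is the value at
  -- 0 of a convolution with a parameter.
  let ν' : Measure (EuclideanSpace ℝ (Fin k)) := (ν.restrict e.source).map e
  have hν'fin : IsFiniteMeasure ν' := inferInstance
  have hν'T : ν'.restrict e.target = ν' := by
    refine Measure.restrict_eq_self_of_ae_mem ?_
    refine (ae_map_iff hem hTo.measurableSet).2 ?_
    filter_upwards [ae_restrict_mem hSo.measurableSet] with a ha using e.map_source ha
  have hconvert : ∀ x ∈ s, ∫ a, K x a • f a ∂ν =
      ∫ t, K x (e.symm t) • f (e.symm t) ∂ν' := by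
    intro x hx
    have h1 : ∫ a, K x a • f a ∂ν = ∫ a in e.source, K x a • f a ∂ν := by
      refine (setIntegral_eq_integral_of_forall_compl_eq_zero fun a ha => ?_).symm
      rw [hK0 x hx a fun h => ha (hCs h), zero_smul]
    rw [h1, integral_map hem]
    · refine setIntegral_congr_fun hSo.measurableSet fun a ha => ?_
      simp only [e.left_inv ha]
    · rw [show Measure.map e (ν.restrict e.source) = ν'.restrict e.target from hν'T.symm]
      refine ContinuousOn.aestronglyMeasurable ?_ hTo.measurableSet
      refine ContinuousOn.smul ?_ (hf.comp_continuousOn hesc)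
      exact hK.continuousOn.comp (f := fun t => (x, t)) (by fun_prop) fun t ht => ⟨hx, ht⟩
  let f' : EuclideanSpace ℝ (Fin k) → R := e.target.indicator (f ∘ e.symm)
  -- A convolution evaluated at 0 reads its second factor at `-t`, hence the sign.
  let g : EuclideanSpace ℝ (Fin k) → EuclideanSpace ℝ (Fin k) → ℝ :=
    fun x y => e.target.indicator (fun t => K x (e.symm t)) (-y)
  have hg0 : ∀ x ∈ s, ∀ y, -y ∉ e '' C → g x y = 0 := by
    intro x hx y hy
    by_cases h : -y ∈ e.target
    · simp only [g, Set.indicator_of_mem h]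
      exact hK0 x hx _ fun hc => hy ⟨_, hc, e.right_inv h⟩
    · simp only [g, Set.indicator_of_notMem h]
  have hCe : IsCompact (e '' C) := hC.image_of_continuousOn (hec.mono hCs)
  have hf' : LocallyIntegrable f' ν' := by
    apply Integrable.locallyIntegrable
    obtain ⟨B, hB⟩ := isCompact_univ.exists_bound_of_continuousOn hf.continuousOn
    refine Integrable.of_bound (C := max B 0) ?_ (Filter.Eventually.of_forall fun t => ?_)
    · rw [aestronglyMeasurable_indicator_iff hTo.measurableSet]
      exact (hf.comp_continuousOn hesc).aestronglyMeasurable hTo.measurableSet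
    · by_cases h : t ∈ e.target
      · simp only [f', Set.indicator_of_mem h]
        exact (hB _ (Set.mem_univ _)).trans (le_max_left _ _)
      · simp [f', Set.indicator_of_notMem h]
  have hsmooth : ContDiffOn ℝ ∞ (Function.uncurry g) (s ×ˢ Set.univ) := by
    rintro ⟨x, y⟩ ⟨hx, -⟩
    apply ContDiffAt.contDiffWithinAt
    have hx' : ∀ᶠ q : EuclideanSpace ℝ (Fin k) × EuclideanSpace ℝ (Fin k) in nhds (x, y),
        q.1 ∈ s := continuous_fst.continuousAt.eventually_mem (hs.mem_nhds hx)
    by_cases hy : -y ∈ e.target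
    · have h1 : ContDiffAt ℝ ∞ (fun q : EuclideanSpace ℝ (Fin k) × EuclideanSpace ℝ (Fin k) =>
          K q.1 (e.symm (-q.2))) (x, y) := by
        have := (hK.contDiffAt ((hs.prod hTo).mem_nhds (x := (x, -y)) ⟨hx, hy⟩)).comp (x, y)
          (f := fun q : EuclideanSpace ℝ (Fin k) × EuclideanSpace ℝ (Fin k) => (q.1, -q.2))
          (by fun_prop)
        exact this
      refine h1.congr_of_eventuallyEq ?_
      have : ∀ᶠ q : EuclideanSpace ℝ (Fin k) × EuclideanSpace ℝ (Fin k) in nhds (x, y),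
        -q.2 ∈ e.target := (continuous_snd.neg).continuousAt.eventually_mem (hTo.mem_nhds hy)
      filter_upwards [this] with q hq
      simp only [Function.uncurry, g, Set.indicator_of_mem hq]
    · have hyC : -y ∉ e '' C := fun h => hy (by
        obtain ⟨a, ha, hay⟩ := h
        exact hay ▸ e.map_source (hCs ha))
      have : ∀ᶠ q : EuclideanSpace ℝ (Fin k) × EuclideanSpace ℝ (Fin k) in nhds (x, y),
        -q.2 ∈ (e '' C)ᶜ := (continuous_snd.neg).continuousAt.eventually_mem
          (hCe.isClosed.isOpen_compl.mem_nhds hyC)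
      refine (contDiffAt_const (c := (0 : ℝ))).congr_of_eventuallyEq ?_
      filter_upwards [this, hx'] with q hq hqs
      exact hg0 _ hqs _ hq
  have hconv := contDiffOn_convolution_right_with_param (μ := ν') (n := ⊤) (g := g)
    (ContinuousLinearMap.lsmul ℝ ℝ : ℝ →L[ℝ] R →L[ℝ] R).flip hs hCe.neg
    (fun x y hx hy => hg0 x hx y (by simpa using hy)) hf' hsmooth
  have h2 : ContDiffAt ℝ ∞ (fun x => convolution f' (g x)
      (ContinuousLinearMap.lsmul ℝ ℝ : ℝ →L[ℝ] R →L[ℝ] R).flip ν' 0) x₀ :=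
    (hconv.contDiffAt ((hs.prod isOpen_univ).mem_nhds (x := (x₀, 0)) ⟨hx₀, Set.mem_univ _⟩)).comp x₀
      (f := fun x => (x, (0 : EuclideanSpace ℝ (Fin k)))) (by fun_prop)
  refine h2.congr_of_eventuallyEq ?_
  filter_upwards [hs.mem_nhds hx₀] with x hx
  rw [hconvert x hx, convolution, ← hν'T]
  refine setIntegral_congr_fun hTo.measurableSet fun t ht => ?_
  simp [f', g, Set.indicator_of_mem ht]

variable [T2Space G] [Group G] [LieGroup (𝓡 k) ∞ G] [CompleteSpace R]

/-- A continuous representation of a compact Lie group is smooth. -/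
theorem contMDiff_of_continuous_monoidHom (ρ : G →* R) (hρ : Continuous ρ) :
    ContMDiff (𝓡 k) 𝓘(ℝ, R) ∞ ρ := by
  have : IsTopologicalGroup G := topologicalGroup_of_lieGroup (𝓡 k) ∞
  suffices h : ContMDiffAt (𝓡 k) 𝓘(ℝ, R) ∞ ρ 1 by
    intro a
    have h1 : ContMDiffAt (𝓡 k) (𝓡 k) ∞ (fun b : G => a⁻¹ * b) a :=
      contMDiff_mul_left.contMDiffAt
    have h2 : ContMDiffAt (𝓡 k) 𝓘(ℝ, R) ∞ (fun b : G => ρ (a⁻¹ * b)) a :=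
      ContMDiffAt.comp a (g := ρ) (by simpa using h) h1
    have h3 : ContDiff ℝ ∞ (fun z : R => ρ a * z) := by fun_prop
    have h4 := h3.contMDiff.contMDiffAt.comp a h2
    refine h4.congr_of_eventuallyEq (Filter.Eventually.of_forall fun b => ?_)
    simp [← map_mul]
  borelize G
  let ν : Measure G := Measure.haar
  set e := extChartAt (𝓡 k) (1 : G) with he
  obtain ⟨C, hC1, hCS, hC⟩ : ∃ C ∈ nhds (1 : G), C ⊆ e.source ∧ IsCompact C :=
    have : LocallyCompactSpace G := ChartedSpace.locallyCompactSpace (EuclideanSpace ℝ (Fin k)) G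
    local_compact_nhds (extChartAt_source_mem_nhds (I := 𝓡 k) (1 : G))
  obtain ⟨W, hWo, hW1, hWC⟩ := exists_open_nhds_one_mul_subset hC1
  have hV : {a : G | ‖ρ a - 1‖ < 1 / 2} ∈ nhds (1 : G) := by
    have : Continuous fun a => ‖ρ a - 1‖ := by fun_prop
    exact (isOpen_lt this continuous_const).mem_nhds (by simp)
  obtain ⟨ψ, -, hψ⟩ := ((SmoothBumpFunction.nhds_basis_support (I := 𝓡 k)
    (Filter.inter_mem (hWo.mem_nhds hW1) hV)).mem_iff).1 (Filter.inter_mem (hWo.mem_nhds hW1) hV)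
  have hψc : Continuous ψ := ψ.continuous
  have hint : ∀ {F : G → R}, Continuous F → Integrable F ν := fun h =>
    h.integrable_of_hasCompactSupport (HasCompactSupport.of_compactSpace _)
  set S : ℝ := ∫ a, ψ a ∂ν with hS
  have hψint : Integrable ψ ν :=
    hψc.integrable_of_hasCompactSupport (HasCompactSupport.of_compactSpace _)
  have hSpos : 0 < S :=
    hψc.integral_pos_of_hasCompactSupport_nonneg_nonzero (x := 1)
      (HasCompactSupport.of_compactSpace _) (fun a => ψ.nonneg) (by rw [ψ.eq_one]; simp)
  set A : R := ∫ a, ψ a • ρ a ∂ν with hA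
  -- `A` averages `ρ` over points where it is within `1 / 2` of `1`; so `S⁻¹ • A` is close to `1`
  -- and `A` is invertible.
  have hAnorm : ‖1 - S⁻¹ • A‖ < 1 := by
    have h1 : S • (1 : R) - A = ∫ a, ψ a • (1 - ρ a) ∂ν := by
      simp only [smul_sub]
      rw [integral_sub (hint (by fun_prop)) (hint (by fun_prop)), integral_smul_const]
    have h2 : ‖S • (1 : R) - A‖ ≤ S * (1 / 2) := by
      rw [h1, hS, ← integral_mul_const]
      refine norm_integral_le_of_norm_le (hψint.mul_const _) (Filter.Eventually.of_forall fun a => ?_)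
      rw [norm_smul, Real.norm_of_nonneg ψ.nonneg]
      by_cases ha : a ∈ Function.support ψ
      · have := (hψ ha).2
        rw [norm_sub_rev]
        exact mul_le_mul_of_nonneg_left (le_of_lt this) ψ.nonneg
      · rw [Function.notMem_support.1 ha]; simp
    have h3 : 1 - S⁻¹ • A = S⁻¹ • (S • (1 : R) - A) := by
      rw [smul_sub, inv_smul_smul₀ hSpos.ne']
    rw [h3, norm_smul, Real.norm_of_nonneg (inv_pos.2 hSpos).le]
    calc S⁻¹ * _ ≤ S⁻¹ * (S * (1 / 2)) := by gcongr
      _ = 1 / 2 := by field_simp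
      _ < 1 := by norm_num
  obtain ⟨A', hA'⟩ : ∃ A' : R, A * A' = 1 := by
    let U := Units.oneSub (1 - S⁻¹ • A) hAnorm
    refine ⟨S⁻¹ • ((U⁻¹ : Rˣ) : R), ?_⟩
    have h1 : (U : R) = S⁻¹ • A := by simp [U]
    rw [mul_smul_comm, ← smul_mul_assoc, ← h1, Units.mul_inv]
  -- Invariance of Haar measure moves the variable `b` from `ρ`, which is only continuous, to the
  -- smooth bump `ψ`.
  have hFeq : ∀ b : G, ρ b = (∫ a, ψ (b⁻¹ * a) • ρ a ∂ν) * A' := by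
    intro b
    have h1 : ∫ a, ψ (b⁻¹ * a) • ρ a ∂ν = ρ b * A := by
      rw [← integral_mul_left_eq_self _ b, hA, ← integral_const_mul_of_integrable]
      · refine integral_congr_ae (Filter.Eventually.of_forall fun a => ?_)
        simp
      · exact hint (by fun_prop)
    rw [h1, mul_assoc, hA', mul_one]
  -- For `b ∈ W` the support of `a ↦ ψ (b⁻¹ * a)` lies in `W * W ⊆ C`, inside one chart.
  let s : Set (EuclideanSpace ℝ (Fin k)) := e.target ∩ e.symm ⁻¹' W
  have hs : IsOpen s :=
    (continuousOn_extChartAt_symm (I := 𝓡 k) (1 : G)).isOpen_inter_preimage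
      (isOpen_extChartAt_target 1) hWo
  have hx₀ : e 1 ∈ s := ⟨mem_extChartAt_target 1, by
    simpa [he] using hW1⟩
  have hsymm : ContMDiffOn (𝓡 k) (𝓡 k) ∞ e.symm e.target := contMDiffOn_extChartAt_symm 1
  have hF : ContDiffAt ℝ ∞ (fun x => ∫ a, ψ ((e.symm x)⁻¹ * a) • ρ a ∂ν) (e 1) := by
    refine contDiffAt_integral_of_tsupport_subset ν hρ hs hx₀ 1 hC hCS ?_ ?_
    · intro x hx a ha
      by_contra h
      exact ha (hWC ⟨_, hx.2, _, (hψ h).1, by simp⟩)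
    · rw [← contMDiffOn_iff_contDiffOn]
      refine ψ.contMDiff.comp_contMDiffOn (ContMDiffOn.mul (ContMDiffOn.inv ?_) ?_)
      · exact hsymm.comp contDiff_fst.contMDiff.contMDiffOn fun q hq => hq.1.1
      · exact hsymm.comp contDiff_snd.contMDiff.contMDiffOn fun q hq => hq.2
  have h5 : ContDiffAt ℝ ∞ (fun x => (∫ a, ψ ((e.symm x)⁻¹ * a) • ρ a ∂ν) * A') (e 1) :=
    hF.mul contDiffAt_const
  have h6 := h5.contMDiffAt.comp (1 : G) (contMDiffAt_extChartAt (I := 𝓡 k) (n := ∞) (x := (1 : G)))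
  refine h6.congr_of_eventuallyEq ?_
  filter_upwards [extChartAt_source_mem_nhds (I := 𝓡 k) (1 : G)] with a ha
  simp only [Function.comp]
  rw [e.left_inv ha, ← hFeq]

end SmoothRepresentation

/-! ### Evaluation vectors of an invariant function space. -/

section EvaluationMap

variable {M : Type*} [MeasurableSpace M] {μ : Measure M} {E : Submodule ℝ (Lp ℝ 2 μ)}
  [FiniteDimensional ℝ E]

variable (E) in
/-- A measurable family of vectors representing the evaluation functionals almost everywhere. -/
theorem exists_evaluation_ae :
    ∃ Φ : M → E, StronglyMeasurable Φ ∧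
      ∀ u : E, (u : Lp ℝ 2 μ) =ᵐ[μ] fun x => inner ℝ (Φ x) u := by
  let b := stdOrthonormalBasis ℝ E
  -- The reproducing kernel, built from measurable representatives of an orthonormal basis.
  refine ⟨fun x => ∑ i, ((b i : E) : Lp ℝ 2 μ) x • b i, ?_, fun u => ?_⟩
  · exact Finset.stronglyMeasurable_fun_sum _ fun i _ =>
      (Lp.stronglyMeasurable _).smul_const _
  · have key : ∀ (s : Finset (Fin (Module.finrank ℝ E))) (c : Fin (Module.finrank ℝ E) → ℝ),
        ((∑ i ∈ s, c i • b i : E) : Lp ℝ 2 μ) =ᵐ[μ]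
          fun x => ∑ i ∈ s, c i * ((b i : E) : Lp ℝ 2 μ) x := by
      intro s c
      induction s using Finset.induction_on with
      | empty => simp only [Finset.sum_empty, Submodule.coe_zero]; exact Lp.coeFn_zero ℝ 2 μ
      | insert i s hi ih =>
        rw [Finset.sum_insert hi, Submodule.coe_add, Submodule.coe_smul]
        filter_upwards [Lp.coeFn_add (c i • ((b i : E) : Lp ℝ 2 μ)) (∑ i ∈ s, c i • b i : E),
          Lp.coeFn_smul (c i) ((b i : E) : Lp ℝ 2 μ), ih] with x h1 h2 h3
        rw [h1, Pi.add_apply, h2, h3, Finset.sum_insert hi, Pi.smul_apply, smul_eq_mul]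
    have h := key Finset.univ fun i => inner ℝ (b i) u
    rw [b.sum_repr'] at h
    filter_upwards [h] with x hx
    rw [hx, sum_inner]
    refine Finset.sum_congr rfl fun i _ => ?_
    exact (mul_comm _ _).trans (real_inner_smul_left (b i) u _).symm

/-- The trace of an operator in terms of the evaluation vectors. -/
theorem trace_eq_of_evaluation [IsProbabilityMeasure μ] {φ : M → E}
    (hφ : ∀ u : E, (u : Lp ℝ 2 μ) =ᵐ[μ] fun x => inner ℝ (φ x) u) (T : E →ₗ[ℝ] E) {τ : ℝ}
    (hτ : ∀ x, inner ℝ (φ x) (T (φ x)) = τ) : LinearMap.trace ℝ E T = τ := by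
  let b := stdOrthonormalBasis ℝ E
  have hprod : ∀ u v : E, (fun x => (u : Lp ℝ 2 μ) x * (v : Lp ℝ 2 μ) x) =ᵐ[μ]
      fun x => inner ℝ (φ x) u * inner ℝ (φ x) v := fun u v => by
    filter_upwards [hφ u, hφ v] with x h1 h2
    rw [h1, h2]
  have hi : ∀ u v : E, Integrable (fun x => inner ℝ (φ x) u * inner ℝ (φ x) v) μ := fun u v =>
    ((Lp.memLp (u : Lp ℝ 2 μ)).integrable_mul (Lp.memLp (v : Lp ℝ 2 μ))).congr (hprod u v)
  have hinner : ∀ u v : E, inner ℝ u v = ∫ x, inner ℝ (φ x) u * inner ℝ (φ x) v ∂μ := by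
    intro u v
    rw [← integral_congr_ae (hprod u v), Submodule.coe_inner, L2.inner_def]
    refine integral_congr_ae (Filter.Eventually.of_forall fun x => ?_)
    simp [mul_comm]
  -- The trace becomes the integral of `∑ i, ⟨φ x, b i⟩ ⟨φ x, T (b i)⟩`, and this sum is `⟨φ x, T (φ
  -- x)⟩`.
  rw [LinearMap.trace_eq_sum_inner T b]
  rw [Finset.sum_congr rfl fun i _ => hinner (b i) (T (b i))]
  rw [← integral_finsetSum _ fun i _ => hi _ _]
  have h : ∀ x, ∑ i, inner ℝ (φ x) (b i) * inner ℝ (φ x) (T (b i)) = τ := by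
    intro x
    rw [← hτ x]
    conv_rhs => rw [← b.sum_repr' (φ x)]
    simp only [map_sum, map_smul, inner_sum]
    refine Finset.sum_congr rfl fun i _ => ?_
    rw [b.sum_repr', real_inner_comm (φ x) (b i)]
    exact (real_inner_smul_right _ _ _).symm
  rw [integral_congr_ae (g := fun _ => τ) (Filter.Eventually.of_forall h), integral_const,
    probReal_univ, one_smul]

/-- The trace formula for the identity operator: the mean of `‖φ‖²` is the dimension. -/
theorem norm_sq_evaluation [IsProbabilityMeasure μ] {φ : M → E}
    (hφ : ∀ u : E, (u : Lp ℝ 2 μ) =ᵐ[μ] fun x => inner ℝ (φ x) u)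
    (hn : ∀ x y, ‖φ x‖ = ‖φ y‖) (x : M) : ‖φ x‖ ^ 2 = Module.finrank ℝ E := by
  rw [← LinearMap.trace_id, trace_eq_of_evaluation hφ LinearMap.id (τ := ‖φ x‖ ^ 2) fun y => by
    rw [LinearMap.id_apply, real_inner_self_eq_norm_sq, hn x y]]

omit [FiniteDimensional ℝ E] in
/-- A space of functions orthogonal to the constants has no constant evaluation map. -/
theorem eq_bot_of_evaluation_const [IsProbabilityMeasure μ] {φ : M → E}
    (hφ : ∀ u : E, (u : Lp ℝ 2 μ) =ᵐ[μ] fun x => inner ℝ (φ x) u)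
    (horth : ∀ u ∈ E, inner ℝ (Lp.const 2 μ (1 : ℝ)) u = 0)
    (hc : ∀ x y, φ x = φ y) : E = ⊥ := by
  obtain ⟨o⟩ : Nonempty M := nonempty_of_isProbabilityMeasure μ
  rw [Submodule.eq_bot_iff]
  intro u hu
  have h1 : (u : M → ℝ) =ᵐ[μ] fun _ => inner ℝ (φ o) (⟨u, hu⟩ : E) := by
    filter_upwards [hφ ⟨u, hu⟩] with x hx
    rw [← hc x o, ← hx]
  have h2 := horth u hu
  rw [L2.inner_def, integral_congr_ae (g := fun _ => inner ℝ (φ o) (⟨u, hu⟩ : E))] at h2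
  · rw [integral_const, probReal_univ, one_smul] at h2
    rw [h2] at h1
    exact (Lp.eq_zero_iff_ae_eq_zero).2 h1
  · filter_upwards [h1, Lp.coeFn_const 2 μ (1 : ℝ)] with x h3 h4
    rw [h3, h4]
    simp

variable [TopologicalSpace M] [T2Space M] [SecondCountableTopology M] [BorelSpace M]
  [IsProbabilityMeasure μ] {G : Type*} [TopologicalSpace G] [Group G] [IsTopologicalGroup G]
  [MulAction G M] [ContinuousSMul G M] [SMulInvariantMeasure G M μ]

/-- The representation of `G` on an invariant subspace of `L²`. -/
theorem exists_translation_representation [CompactSpace M] (hinv : IsTranslationInvariant G μ E) :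
    ∃ ρ : G →* (E →L[ℝ] E), Continuous ρ ∧
      (∀ a u v, inner ℝ (ρ a u) (ρ a v) = inner ℝ u v) ∧
      ∀ (a : G) (u : E), (ρ a u : Lp ℝ 2 μ) =ᵐ[μ] fun x => (u : Lp ℝ 2 μ) (a⁻¹ • x) := by
  borelize G
  have : Fact ((2 : ENNReal) ≠ ⊤) := ⟨by simp⟩
  have hae : ∀ (a : G) (u : Lp ℝ 2 μ), (DomMulAct.mk a • u : Lp ℝ 2 μ) =ᵐ[μ] fun x => u (a • x) :=
    fun a u => DomMulAct.smul_Lp_ae_eq _ _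
  have hmem : ∀ (a : G), ∀ u ∈ E, DomMulAct.mk a • u ∈ E := by
    intro a u hu
    obtain ⟨w, hw, hwu⟩ := hinv a u hu
    have : DomMulAct.mk a • u = w := Lp.ext ((hae a u).trans hwu.symm)
    rwa [this]
  let L : G → E →ₗ[ℝ] E := fun a =>
    { toFun := fun u => ⟨DomMulAct.mk a⁻¹ • (u : Lp ℝ 2 μ), hmem _ _ u.2⟩
      map_add' := fun u v => Subtype.ext (smul_add _ _ _)
      map_smul' := fun r u => Subtype.ext (smul_comm _ _ _) }
  have hL : ∀ a u, ((L a u : E) : Lp ℝ 2 μ) = DomMulAct.mk a⁻¹ • (u : Lp ℝ 2 μ) := fun _ _ => rfl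
  have hnorm : ∀ a u, ‖L a u‖ = ‖u‖ := fun a u => DomMulAct.norm_smul_Lp _ _
  let ρ : G →* (E →L[ℝ] E) :=
    { toFun := fun a => LinearMap.toContinuousLinearMap (L a)
      map_one' := by
        ext1 u
        apply Subtype.ext
        simp [hL]
      map_mul' := fun a b => by
        ext1 u
        apply Subtype.ext
        simp [hL, mul_smul] }
  have hρ : ∀ a u, ρ a u = L a u := fun _ _ => rfl
  refine ⟨ρ, ?_, fun a u v => ?_, fun a u => ?_⟩
  -- In finite dimension norm continuity is pointwise continuity, which is the continuity of
  -- translations in `L²`.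
  · rw [continuous_clm_apply]
    intro u
    refine Continuous.subtype_mk ?_ _
    have h1 : Continuous fun a : G => DomMulAct.mk a⁻¹ :=
      DomMulAct.continuous_mk.comp continuous_inv
    exact h1.smul continuous_const
  · let I : E →ₗᵢ[ℝ] E := ⟨L a, hnorm a⟩
    exact I.inner_map_map u v
  · exact hae _ _

variable [CompactSpace G] [T2Space G] [SecondCountableTopology G] [MulAction.IsPretransitive G M]

/-- A continuous equivariant family of vectors representing the evaluation functionals. -/
theorem exists_equivariant_evaluation {ρ : G →* (E →L[ℝ] E)} (hρc : Continuous ρ)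
    (hρi : ∀ a u v, inner ℝ (ρ a u) (ρ a v) = inner ℝ u v)
    (hρ : ∀ (a : G) (u : E), (ρ a u : Lp ℝ 2 μ) =ᵐ[μ] fun x => (u : Lp ℝ 2 μ) (a⁻¹ • x)) :
    ∃ φ : M → E, Continuous φ ∧ (∀ a x, φ (a • x) = ρ a (φ x)) ∧
      ∀ u : E, (u : Lp ℝ 2 μ) =ᵐ[μ] fun x => inner ℝ (φ x) u := by
  borelize G
  borelize ↥E
  let ν : Measure G := Measure.haar
  obtain ⟨Φ, hΦm, hΦ⟩ := exists_evaluation_ae (μ := μ) E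
  have hρinv : ∀ a u, ρ a⁻¹ (ρ a u) = u := fun a u => by
    rw [← mul_apply_eq_comp, ← map_mul, inv_mul_cancel, map_one]
    rfl
  have hinj : ∀ a, Function.Injective (ρ a) := fun a => Function.LeftInverse.injective (hρinv a)
  -- equivariance almost everywhere
  have hB : ∀ a : G, ∀ᵐ x ∂μ, Φ (a • x) = ρ a (Φ x) := by
    intro a
    let b := stdOrthonormalBasis ℝ E
    have h1 : ∀ i, ∀ᵐ x ∂μ, inner ℝ (Φ (a • x)) (b i) = inner ℝ (ρ a (Φ x)) (b i) := by
      intro i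
      have h2 := tendsto_smul_ae μ a (hΦ (b i))
      filter_upwards [h2, hρ a⁻¹ (b i), hΦ (ρ a⁻¹ (b i))] with x h3 h4 h5
      have h6 : ((b i : E) : Lp ℝ 2 μ) (a • x) = inner ℝ (Φ (a • x)) (b i) := h3
      rw [← h6, ← hρi a⁻¹ (ρ a (Φ x)), hρinv, ← h5, h4, inv_inv]
    filter_upwards [ae_all_iff.2 h1] with x hx
    exact InnerProductSpace.ext_inner_right_basis b.toBasis (by simpa using hx)
  have hmeas : Measurable fun q : G × M => q.1 • q.2 := continuous_smul.measurable
  -- Fubini produces a point `x₀` at which equivariance holds for almost every group element.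
  have hC : ∀ᵐ x ∂μ, ∀ᵐ a ∂ν, Φ (a • x) = ρ a (Φ x) := by
    rw [← Measure.ae_ae_comm (μ := ν) (ν := μ) (p := fun a x => Φ (a • x) = ρ a (Φ x))]
    · exact Filter.Eventually.of_forall hB
    · refine measurableSet_eq_fun (hΦm.measurable.comp hmeas) ?_
      have h1 : Continuous fun q : G × E => ρ q.1 q.2 :=
        (hρc.comp continuous_fst).clm_apply continuous_snd
      exact h1.measurable.comp (measurable_fst.prodMk (hΦm.measurable.comp measurable_snd))
  obtain ⟨x₀, hx₀⟩ := hC.exists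
  have hright : ∀ (h : G) {p : G → Prop}, (∀ᵐ a ∂ν, p a) → ∀ᵐ a ∂ν, p (a * h) := fun h p hp =>
    (quasiMeasurePreserving_mul_right ν h).ae hp
  -- Some `a` satisfies the relation together with `a * h`; both give the value of `Φ` at the same
  -- point `a • x₀`.
  have hstab : ∀ h : G, h • x₀ = x₀ → ρ h (Φ x₀) = Φ x₀ := by
    intro h hh
    obtain ⟨a, h1, h2⟩ := (hx₀.and (hright h hx₀)).exists
    rw [mul_smul, hh, h1, map_mul, mul_apply_eq_comp] at h2
    exact (hinj a h2).symm
  choose s hs using fun x : M => MulAction.exists_smul_eq G x₀ x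
  let φ : M → E := fun x => ρ (s x) (Φ x₀)
  have hφ : ∀ a, φ (a • x₀) = ρ a (Φ x₀) := by
    intro a
    have h1 : ρ (a⁻¹ * s (a • x₀)) (Φ x₀) = Φ x₀ := hstab _ (by
      rw [mul_smul, hs, inv_smul_smul])
    calc φ (a • x₀) = ρ (a * (a⁻¹ * s (a • x₀))) (Φ x₀) := by rw [mul_inv_cancel_left]
      _ = _ := by rw [map_mul, mul_apply_eq_comp, h1]
  have hequiv : ∀ a x, φ (a • x) = ρ a (φ x) := by
    intro a x
    obtain ⟨b, rfl⟩ := MulAction.exists_smul_eq G x₀ x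
    rw [smul_smul, hφ, hφ, map_mul, mul_apply_eq_comp]
  have horb : Continuous fun a : G => a • x₀ := by fun_prop
  have hφc : Continuous φ := by
    -- The orbit map goes from a compact space onto a Hausdorff one, so continuity can be tested on
    -- `G`.
    have hq : Topology.IsQuotientMap fun a : G => a • x₀ :=
      horb.isClosedMap.isQuotientMap horb fun x => MulAction.exists_smul_eq G x₀ x
    rw [hq.continuous_iff]
    have : φ ∘ (fun a : G => a • x₀) = fun a => ρ a (Φ x₀) := funext hφ
    rw [this]
    exact hρc.clm_apply continuous_const
  -- Fubini in the other direction: agreement at `a • x` for every `x` and almost every `a` gives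
  -- one `a` that works for almost every `x`.
  have hΦφ : Φ =ᵐ[μ] φ := by
    have h1 : ∀ x, ∀ᵐ a ∂ν, Φ (a • x) = φ (a • x) := by
      intro x
      obtain ⟨b, rfl⟩ := MulAction.exists_smul_eq G x₀ x
      filter_upwards [hright b hx₀] with a ha
      rw [smul_smul, ha, hφ]
    have h2 : ∀ᵐ a ∂ν, ∀ᵐ x ∂μ, Φ (a • x) = φ (a • x) := by
      rw [Measure.ae_ae_comm (μ := ν) (ν := μ) (p := fun a x => Φ (a • x) = φ (a • x))]
      · exact Filter.Eventually.of_forall h1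
      · exact measurableSet_eq_fun (hΦm.measurable.comp hmeas) (hφc.measurable.comp hmeas)
    obtain ⟨a, ha⟩ := h2.exists
    have h3 := tendsto_smul_ae μ a⁻¹ ha
    filter_upwards [h3] with x hx
    simpa using hx
  refine ⟨φ, hφc, hequiv, fun u => ?_⟩
  filter_upwards [hΦ u, hΦφ] with x h1 h2
  rw [h1, h2]

end EvaluationMap

/-! ### Smooth maps with vanishing or surjective differential. -/

section Charts

variable {k m : ℕ} {N M : Type*} [TopologicalSpace N] [ChartedSpace (EuclideanSpace ℝ (Fin k)) N]
  [IsManifold (𝓡 k) ∞ N] [TopologicalSpace M] [ChartedSpace (EuclideanSpace ℝ (Fin m)) M]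

omit [IsManifold (𝓡 k) ∞ N] in
theorem isInvertible_mfderiv_extChartAt_symm [IsManifold (𝓡 k) 1 N] {x : N}
    {y : EuclideanSpace ℝ (Fin k)} (hy : y ∈ (extChartAt (𝓡 k) x).target) :
    (mfderiv (𝓡 k) (𝓡 k) (extChartAt (𝓡 k) x).symm y).IsInvertible := by
  have := isInvertible_mfderivWithin_extChartAt_symm (I := 𝓡 k) hy
  rwa [ModelWithCorners.range_eq_univ, mfderivWithin_univ] at this

theorem contMDiffAt_extChartAt_symm {x : N} {y : EuclideanSpace ℝ (Fin k)}
    (hy : y ∈ (extChartAt (𝓡 k) x).target) :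
    ContMDiffAt (𝓡 k) (𝓡 k) ∞ (extChartAt (𝓡 k) x).symm y :=
  (contMDiffOn_extChartAt_symm x).contMDiffAt ((isOpen_extChartAt_target x).mem_nhds hy)

/-- A map with vanishing differential is locally constant. -/
theorem isLocallyConstant_of_mfderiv_eq_zero {E' H' M' : Type*} [NormedAddCommGroup E']
    [NormedSpace ℝ E'] [TopologicalSpace H'] {I' : ModelWithCorners ℝ E' H'} [TopologicalSpace M']
    [ChartedSpace H' M'] [IsManifold I' ∞ M'] {f : N → M'} (hf : MDifferentiable (𝓡 k) I' f)
    (h0 : ∀ x, mfderiv (𝓡 k) I' f x = 0) : IsLocallyConstant f := by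
  have : IsManifold (𝓡 k) 1 N := IsManifold.of_le (n := ∞) (by simp)
  have : IsManifold I' 1 M' := IsManifold.of_le (n := ∞) (by simp)
  rw [IsLocallyConstant.iff_eventually_eq]
  intro x
  set e := extChartAt (𝓡 k) x with he
  set e' := extChartAt I' (f x) with he'
  have hesc : ContinuousOn e.symm e.target := continuousOn_extChartAt_symm x
  set U := e.target ∩ e.symm ⁻¹' (f ⁻¹' e'.source) with hU
  have hUo : IsOpen U := hesc.isOpen_inter_preimage (isOpen_extChartAt_target x)
    ((isOpen_extChartAt_source (f x)).preimage hf.continuous)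
  have hxU : e x ∈ U := by
    refine ⟨mem_extChartAt_target x, ?_⟩
    simp only [Set.mem_preimage]
    rw [e.left_inv (mem_extChartAt_source x)]
    exact mem_extChartAt_source (f x)
  have hder : ∀ y ∈ U, HasFDerivAt (e' ∘ f ∘ e.symm) (0 : EuclideanSpace ℝ (Fin k) →L[ℝ] E') y := by
    intro y hy
    have h1 : MDifferentiableAt (𝓡 k) (𝓡 k) e.symm y :=
      (contMDiffAt_extChartAt_symm hy.1).mdifferentiableAt (by simp)
    have h2 : MDifferentiableAt (𝓡 k) I' f (e.symm y) := hf _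
    have h3 : MDifferentiableAt I' 𝓘(ℝ, E') e' (f (e.symm y)) :=
      mdifferentiableAt_extChartAt (by rw [← extChartAt_source I']; exact hy.2)
    have h4 := h3.hasMFDerivAt.comp y (h2.hasMFDerivAt.comp y h1.hasMFDerivAt)
    rw [h0] at h4
    refine HasFDerivAt.congr_fderiv h4.hasFDerivAt ?_
    rw [ContinuousLinearMap.zero_comp, ContinuousLinearMap.comp_zero]
    rfl
  obtain ⟨r, hr, hball⟩ := Metric.isOpen_iff.1 hUo _ hxU
  have hconst : ∀ y ∈ Metric.ball (e x) r, (e' ∘ f ∘ e.symm) y = (e' ∘ f ∘ e.symm) (e x) :=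
    fun y hy => Metric.isOpen_ball.is_const_of_fderiv_eq_zero (𝕜 := ℝ)
      (convex_ball _ _).isPreconnected
      (fun z hz => (hder z (hball hz)).differentiableAt.differentiableWithinAt)
      (fun z hz => (hder z (hball hz)).fderiv) hy (Metric.mem_ball_self hr)
  filter_upwards [(continuousAt_extChartAt (I := 𝓡 k) x).eventually_mem
    (Metric.ball_mem_nhds _ hr), extChartAt_source_mem_nhds (I := 𝓡 k) x] with z hz hzs
  have h1 := hconst _ hz
  have h2 := (hball hz).2
  simp only [Function.comp, Set.mem_preimage] at h1 h2
  rw [e.left_inv hzs] at h1 h2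
  rw [e.left_inv (mem_extChartAt_source x)] at h1
  exact e'.injOn h2 (mem_extChartAt_source (f x)) h1

/-- A smooth map with surjective differential has smooth local sections. -/
theorem exists_local_section {f : N → M} (hf : ContMDiff (𝓡 k) (𝓡 m) ∞ f) (a : N)
    (hsurj : Function.Surjective (mfderiv (𝓡 k) (𝓡 m) f a)) :
    ∃ σ : M → N, ContMDiffAt (𝓡 m) (𝓡 k) ∞ σ (f a) ∧ ∀ᶠ x in nhds (f a), f (σ x) = x := by
  set e := extChartAt (𝓡 k) a with he
  set e' := extChartAt (𝓡 m) (f a) with he'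
  set F : EuclideanSpace ℝ (Fin k) → EuclideanSpace ℝ (Fin m) := e' ∘ f ∘ e.symm with hF
  have hFs : ContDiffAt ℝ ∞ F (e a) := by
    have := (contMDiffAt_iff.1 (hf a)).2
    rwa [ModelWithCorners.range_eq_univ, contDiffWithinAt_univ] at this
  have hFa : F (e a) = e' (f a) := by
    simp only [hF, Function.comp]
    rw [e.left_inv (mem_extChartAt_source a)]
  have hFd : fderiv ℝ F (e a) = mfderiv (𝓡 k) (𝓡 m) f a := by
    have := MDifferentiableAt.mfderiv ((hf a).mdifferentiableAt (by simp))
    simp only [ModelWithCorners.range_eq_univ, fderivWithin_univ] at this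
    exact this.symm
  have hsurj' : LinearMap.range (fderiv ℝ F (e a) : EuclideanSpace ℝ (Fin k) →ₗ[ℝ]
      EuclideanSpace ℝ (Fin m)) = ⊤ := by
    rw [LinearMap.range_eq_top, hFd]
    exact hsurj
  obtain ⟨R, hR⟩ := (fderiv ℝ F (e a) : EuclideanSpace ℝ (Fin k) →ₗ[ℝ]
      EuclideanSpace ℝ (Fin m)).exists_rightInverse_of_surjective hsurj'
  set R' : EuclideanSpace ℝ (Fin m) →L[ℝ] EuclideanSpace ℝ (Fin k) :=
    LinearMap.toContinuousLinearMap R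
  set v₀ := e' (f a) with hv₀
  -- An affine slice along a right inverse of the differential: `F ∘ A` has identity derivative at
  -- `v₀`, so the inverse function theorem applies.
  set A : EuclideanSpace ℝ (Fin m) → EuclideanSpace ℝ (Fin k) := fun v => e a + R' (v - v₀) with hA
  have hAv : A v₀ = e a := by simp [hA]
  have hAs : ContDiff ℝ ∞ A := by fun_prop
  have hβ : ContDiffAt ℝ ∞ (F ∘ A) v₀ := ContDiffAt.comp v₀ (hAv ▸ hFs) hAs.contDiffAt
  have hβd : HasFDerivAt (F ∘ A) ((ContinuousLinearEquiv.refl ℝ (EuclideanSpace ℝ (Fin m)) :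
      EuclideanSpace ℝ (Fin m) ≃L[ℝ] EuclideanSpace ℝ (Fin m)) :
      EuclideanSpace ℝ (Fin m) →L[ℝ] EuclideanSpace ℝ (Fin m)) v₀ := by
    have h1 : HasFDerivAt A R' v₀ := by
      have := (R'.hasFDerivAt.comp v₀ ((hasFDerivAt_id v₀).sub_const v₀)).const_add (e a)
      exact this
    have h2 : HasFDerivAt F (fderiv ℝ F (e a)) (A v₀) := by
      rw [hAv]; exact (hFs.differentiableAt (by simp)).hasFDerivAt
    have h3 := h2.comp v₀ h1
    refine h3.congr_fderiv ?_
    ext1 v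
    exact LinearMap.congr_fun hR v
  have hβv : (F ∘ A) v₀ = v₀ := by rw [Function.comp, hAv, hFa]
  set θ := hβ.localInverse hβd (by simp) with hθ
  have hθs : ContDiffAt ℝ ∞ θ v₀ := by
    have := hβ.to_localInverse hβd (by simp)
    rwa [hβv] at this
  have hθv : θ v₀ = v₀ := by
    have := hβ.localInverse_apply_image hβd (by simp)
    rwa [hβv] at this
  have hθr : ∀ᶠ v in nhds v₀, (F ∘ A) (θ v) = v := by
    have := (hβ.hasStrictFDerivAt' hβd (by simp)).eventually_right_inverse
    rwa [hβv] at this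
  have he's : ContMDiffAt (𝓡 m) (𝓡 m) ∞ e' (f a) := contMDiffAt_extChartAt
  have hin : ContMDiffAt (𝓡 m) (𝓡 k) ∞ (fun x => A (θ (e' x))) (f a) :=
    (hAs.contMDiff.contMDiffAt.comp v₀ hθs.contMDiffAt).comp (f a) he's
  have hin0 : A (θ (e' (f a))) = e a := by rw [← hv₀, hθv, hAv]
  refine ⟨fun x => e.symm (A (θ (e' x))), ?_, ?_⟩
  · refine ContMDiffAt.comp (f a) (g := e.symm) ?_ hin
    rw [hin0]
    exact contMDiffAt_extChartAt_symm (mem_extChartAt_target a)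
  · have h1 : ∀ᶠ x in nhds (f a), f (e.symm (A (θ (e' x)))) ∈ e'.source := by
      have hc : ContinuousAt (fun x => f (e.symm (A (θ (e' x))))) (f a) := by
        refine ContinuousAt.comp (g := f) hf.continuous.continuousAt ?_
        refine ContinuousAt.comp (g := e.symm) ?_ hin.continuousAt
        rw [hin0]
        exact continuousAt_extChartAt_symm a
      refine hc.eventually_mem ?_
      rw [hin0, e.left_inv (mem_extChartAt_source a)]
      exact extChartAt_source_mem_nhds (f a)
    filter_upwards [h1, he's.continuousAt.eventually hθr, extChartAt_source_mem_nhds (I := 𝓡 m) (f a)]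
      with x h2 h3 h4
    exact e'.injOn h2 h4 h3

end Charts

/-! ### Orbit maps and invariant forms under isotropy irreducibility. -/

section Orbits

variable {m k : ℕ} {M : Type*} [TopologicalSpace M] [ChartedSpace (EuclideanSpace ℝ (Fin m)) M]
  {G : Type*} [TopologicalSpace G] [ChartedSpace (EuclideanSpace ℝ (Fin k)) G] [Group G]
  [MulAction G M]

theorem contMDiff_smul_left [ContMDiffSMul (𝓡 k) (𝓡 m) ∞ G M] (a : G) :
    ContMDiff (𝓡 m) (𝓡 m) ∞ (fun x : M => a • x) :=
  (contMDiff_smul (I := 𝓡 k) (I' := 𝓡 m) (n := ∞) (G := G) (M := M)).comp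
    (contMDiff_const.prodMk contMDiff_id)

theorem contMDiff_smul_right [ContMDiffSMul (𝓡 k) (𝓡 m) ∞ G M] (x : M) :
    ContMDiff (𝓡 k) (𝓡 m) ∞ (fun a : G => a • x) :=
  (contMDiff_smul (I := 𝓡 k) (I' := 𝓡 m) (n := ∞) (G := G) (M := M)).comp
    (contMDiff_id.prodMk contMDiff_const)

end Orbits

section IsotropyIrreducible

variable {m k : ℕ} {M : Type*} [TopologicalSpace M] [ChartedSpace (EuclideanSpace ℝ (Fin m)) M]
  [IsManifold (𝓡 m) ∞ M] {g : RiemMetric m M} {G : Type*} [Group G] [MulAction G M]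

/-- An invariant field of symmetric bilinear forms on an isotropy irreducible homogeneous space is
a multiple of the metric. -/
theorem invariant_form_eq [MulAction.IsPretransitive G M] (hisom : ActsByIsometries G g) (o : M)
    (hirr : IsotropyIrreducible m G o)
    (q : ∀ p : M, TangentSpace (𝓡 m) p →ₗ[ℝ] TangentSpace (𝓡 m) p →ₗ[ℝ] ℝ)
    (hq : ∀ p v w, q p v w = q p w v)
    (hinv : ∀ (a : G) (p : M) (v w : TangentSpace (𝓡 m) p),
      q (a • p) (mfderiv (𝓡 m) (𝓡 m) (fun x : M => a • x) p v)
        (mfderiv (𝓡 m) (𝓡 m) (fun x : M => a • x) p w) = q p v w) :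
    ∃ c : ℝ, ∀ p v w, q p v w = c * g.inner p v w := by
  have hfin : FiniteDimensional ℝ (TangentSpace (𝓡 m) o) :=
    inferInstanceAs (FiniteDimensional ℝ (EuclideanSpace ℝ (Fin m)))
  let B : ∀ p : M, TangentSpace (𝓡 m) p →ₗ[ℝ] TangentSpace (𝓡 m) p →ₗ[ℝ] ℝ := fun p =>
    LinearMap.mk₂ ℝ (fun v w => g.inner p v w) (by simp) (by simp) (by simp) (by simp)
  have hBg : ∀ p v w, B p v w = g.inner p v w := fun _ _ _ => rfl
  -- `h • o` equals `o` only propositionally, but every tangent space is the same model space, so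
  -- the forms can be compared on model vectors.
  have htrans : ∀ (r : ∀ p : M, TangentSpace (𝓡 m) p →ₗ[ℝ] TangentSpace (𝓡 m) p →ₗ[ℝ] ℝ)
      (p : M), p = o → ∀ v w : EuclideanSpace ℝ (Fin m), r p v w = r o v w := by
    rintro r _ rfl v w
    rfl
  obtain ⟨c, hc⟩ := eq_smul_of_irreducible (B o) (q o) (fun v w => g.symm o v w)
    (fun v hv => g.pos o v hv) (hq o)
    (fun h : MulAction.stabilizer G o => (isotropyMap (m := m) o h).toLinearMap)
    (fun h v w => by
      rw [hBg o v w, ← hisom h o v w, ← hBg]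
      exact (htrans B _ h.2 _ _).symm)
    (fun h v w => by
      rw [← hinv h o v w]
      exact (htrans q _ h.2 _ _).symm)
    hirr
  refine ⟨c, fun p v w => ?_⟩
  obtain ⟨a, ha⟩ := MulAction.exists_smul_eq G p o
  rw [← hinv a, ← hisom a]
  have : ∀ p' : M, p' = o → ∀ v w, q p' v w = c * g.inner p' v w := by
    rintro _ rfl v w
    exact hc v w
  exact this _ ha _ _

variable [TopologicalSpace G] [ChartedSpace (EuclideanSpace ℝ (Fin k)) G]

/-- With `L` typed on the model spaces, the base point can be replaced by an equal one without a
cast. -/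
theorem HasMFDerivAt.congr_point {F F' H H' : Type*} [NormedAddCommGroup F] [NormedSpace ℝ F]
    [NormedAddCommGroup F'] [NormedSpace ℝ F'] [TopologicalSpace H] [TopologicalSpace H']
    {I : ModelWithCorners ℝ F H} {I' : ModelWithCorners ℝ F' H'} {N N' : Type*}
    [TopologicalSpace N] [ChartedSpace H N] [TopologicalSpace N'] [ChartedSpace H' N']
    {f : N → N'} {x y : N} (h : x = y) {L : F →L[ℝ] F'} (hf : HasMFDerivAt I I' f x L) :
    HasMFDerivAt I I' f y L := by
  subst h
  exact hf

/-- The orbit maps of an isotropy irreducible homogeneous space are submersions. -/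
theorem surjective_mfderiv_orbit [LieGroup (𝓡 k) ∞ G] [ContMDiffSMul (𝓡 k) (𝓡 m) ∞ G M]
    [CompactSpace G] [T2Space M] [ConnectedSpace M] [Nontrivial M]
    [MulAction.IsPretransitive G M] (o : M) (hirr : IsotropyIrreducible m G o) :
    Function.Surjective (mfderiv (𝓡 k) (𝓡 m) (fun a : G => a • o) 1) ∧ 0 < m := by
  set orb : G → M := fun a => a • o with horb
  have horbs : ContMDiff (𝓡 k) (𝓡 m) ∞ orb := contMDiff_smul_right o
  have horbd : MDifferentiable (𝓡 k) (𝓡 m) orb := horbs.mdifferentiable (by simp)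
  let D : EuclideanSpace ℝ (Fin k) →L[ℝ] EuclideanSpace ℝ (Fin m) := mfderiv (𝓡 k) (𝓡 m) orb 1
  have hD : HasMFDerivAt (𝓡 k) (𝓡 m) orb 1 D := (horbd 1).hasMFDerivAt
  let W : Submodule ℝ (TangentSpace (𝓡 m) o) := LinearMap.range
    (D : EuclideanSpace ℝ (Fin k) →ₗ[ℝ] EuclideanSpace ℝ (Fin m))
  have hW : ∀ w : EuclideanSpace ℝ (Fin m), w ∈ W ↔ ∃ x, D x = w := fun w => Iff.rfl
  -- For `h` fixing `o` one has `h • (a • o) = (h * a * h⁻¹) • o`; differentiating at `a = 1` shows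
  -- that the image is invariant.
  have hinv : ∀ h : MulAction.stabilizer G o, ∀ w ∈ W, isotropyMap o h w ∈ W := by
    rintro h _ ⟨x, rfl⟩
    let L : EuclideanSpace ℝ (Fin m) →L[ℝ] EuclideanSpace ℝ (Fin m) := isotropyMap o h
    have hL : HasMFDerivAt (𝓡 m) (𝓡 m) (fun x : M => (h : G) • x) o L :=
      ((contMDiff_smul_left (k := k) (h : G)).mdifferentiable (by simp) o).hasMFDerivAt
    have hL' : HasMFDerivAt (𝓡 m) (𝓡 m) (fun x : M => (h : G) • x) (orb 1) L :=
      hL.congr_point (one_smul G o).symm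
    have h1 := hL'.comp (1 : G) hD
    let κ : G → G := fun a => (h : G) * a * (h : G)⁻¹
    have hκ : ContMDiff (𝓡 k) (𝓡 k) ∞ κ := (contMDiff_const.mul contMDiff_id).mul contMDiff_const
    let K : EuclideanSpace ℝ (Fin k) →L[ℝ] EuclideanSpace ℝ (Fin k) := mfderiv (𝓡 k) (𝓡 k) κ 1
    have hK : HasMFDerivAt (𝓡 k) (𝓡 k) κ 1 K := (hκ.mdifferentiable (by simp) 1).hasMFDerivAt
    have hD' : HasMFDerivAt (𝓡 k) (𝓡 m) orb (κ 1) D := hD.congr_point (by simp [κ])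
    have h2 := hD'.comp (1 : G) hK
    have h3 : (fun x : M => (h : G) • x) ∘ orb = orb ∘ κ := by
      funext a
      have : (h : G)⁻¹ • o = o := inv_smul_eq_iff.2 h.2.symm
      simp only [Function.comp, horb, κ, mul_smul, this]
    rw [h3] at h1
    have h4 : L ∘L D = D ∘L K := hasMFDerivAt_unique h1 h2
    exact ⟨K x, (congrArg (fun T => T x) h4).symm⟩
  rcases hirr W hinv with hbot | htop
  -- A zero differential at `1` propagates to all of `G` by equivariance. The orbit map is then
  -- locally constant on a compact group, so the connected space `M` is finite, hence a point.
  · exfalso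
    have hD0 : D = 0 := by
      ext1 x
      have : D x ∈ W := ⟨x, rfl⟩
      rw [hbot] at this
      exact this
    have h0 : ∀ a, mfderiv (𝓡 k) (𝓡 m) orb a = 0 := by
      intro a
      have h1 : HasMFDerivAt (𝓡 k) (𝓡 k) (fun b : G => a⁻¹ * b) a _ :=
        ((contMDiff_mul_left (I := 𝓡 k) (n := ∞)).mdifferentiable (by simp) a).hasMFDerivAt
      have h2 : HasMFDerivAt (𝓡 k) (𝓡 m) orb (a⁻¹ * a) D := hD.congr_point (by simp)
      have h3 := h2.comp a h1
      have h4 := ((contMDiff_smul_left (M := M) (k := k) (m := m) a).mdifferentiable (by simp)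
        (orb (a⁻¹ * a))).hasMFDerivAt.comp a h3
      have h5 : (fun x : M => a • x) ∘ orb ∘ (fun b : G => a⁻¹ * b) = orb := by
        funext b
        simp [horb, smul_smul]
      rw [h5] at h4
      rw [h4.mfderiv]
      have h6 : ∀ (A : EuclideanSpace ℝ (Fin m) →L[ℝ] EuclideanSpace ℝ (Fin m))
          (B : EuclideanSpace ℝ (Fin k) →L[ℝ] EuclideanSpace ℝ (Fin k)), A ∘L (D ∘L B) = 0 := by
        intro A B
        rw [hD0, ContinuousLinearMap.zero_comp, ContinuousLinearMap.comp_zero]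
      exact h6 _ _
    have hloc := isLocallyConstant_of_mfderiv_eq_zero horbd h0
    have hsurj : Function.Surjective orb := fun x => MulAction.exists_smul_eq G o x
    have hfin : Finite M := by
      have := hloc.range_finite
      rw [hsurj.range_eq] at this
      exact Set.finite_univ_iff.1 this
    exact not_subsingleton M (PreconnectedSpace.trivial_of_discrete)
  · have hs : Function.Surjective D := LinearMap.range_eq_top.1 htop
    refine ⟨hs, Nat.pos_of_ne_zero ?_⟩
    rintro rfl
    have : DiscreteTopology M := by
      have : DiscreteTopology (EuclideanSpace ℝ (Fin 0)) := inferInstance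
      exact ChartedSpace.discreteTopology (EuclideanSpace ℝ (Fin 0)) M
    exact not_subsingleton M (PreconnectedSpace.trivial_of_discrete)

end IsotropyIrreducible

/-! ### Equivariant maps and the derived representation. -/

theorem map_inv_apply_map {G V : Type*} [Group G] [NormedAddCommGroup V] [NormedSpace ℝ V]
    (ρ : G →* (V →L[ℝ] V)) (a : G) (v : V) : ρ a⁻¹ (ρ a v) = v := by
  rw [← mul_apply_eq_comp, ← map_mul, inv_mul_cancel, map_one]
  rfl

theorem vecDeriv_smul {m : ℕ} {M : Type*} [TopologicalSpace M]
    [ChartedSpace (EuclideanSpace ℝ (Fin m)) M] {G : Type*} [Group G] [MulAction G M]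
    {V : Type*} [NormedAddCommGroup V] [NormedSpace ℝ V] {ρ : G →* (V →L[ℝ] V)} {φ : M → V} (a : G)
    (ha : ContMDiff (𝓡 m) (𝓡 m) ∞ (fun x : M => a • x))
    (hφs : ContMDiff (𝓡 m) 𝓘(ℝ, V) ∞ φ) (hφ : ∀ a x, φ (a • x) = ρ a (φ x)) (p : M)
    (v : TangentSpace (𝓡 m) p) :
    vecDeriv φ (a • p) (mfderiv (𝓡 m) (𝓡 m) (fun x : M => a • x) p v) =
      ρ a (vecDeriv φ p v) := by
  have h1 := (hφs.mdifferentiable (by simp) (a • p)).hasMFDerivAt.comp p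
    (ha.mdifferentiable (by simp) p).hasMFDerivAt
  have h2 := ((ρ a).hasFDerivAt (x := φ p)).hasMFDerivAt.comp p
    (hφs.mdifferentiable (by simp) p).hasMFDerivAt
  have h3 : φ ∘ (fun x : M => a • x) = ρ a ∘ φ := funext fun x => hφ a x
  rw [h3] at h1
  exact congrArg (fun T : EuclideanSpace ℝ (Fin m) →L[ℝ] V => T v) (hasMFDerivAt_unique h1 h2)

section EquivariantMaps

variable {m k : ℕ} {M : Type*} [TopologicalSpace M] [ChartedSpace (EuclideanSpace ℝ (Fin m)) M]
  {G : Type*} [TopologicalSpace G] [ChartedSpace (EuclideanSpace ℝ (Fin k)) G]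
  [Group G] [MulAction G M]
  {V : Type*} [NormedAddCommGroup V] [InnerProductSpace ℝ V] {ρ : G →* (V →L[ℝ] V)} {φ : M → V}

/-- The derivative of a representation at the identity. -/
noncomputable def repDeriv (k : ℕ) {G : Type*} [TopologicalSpace G]
    [ChartedSpace (EuclideanSpace ℝ (Fin k)) G] [Group G]
    {V : Type*} [NormedAddCommGroup V] [InnerProductSpace ℝ V] (ρ : G →* (V →L[ℝ] V)) :
    EuclideanSpace ℝ (Fin k) →L[ℝ] (V →L[ℝ] V) :=
  mfderiv (𝓡 k) 𝓘(ℝ, V →L[ℝ] V) ρ 1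

theorem hasMFDerivAt_rep (hρs : ContMDiff (𝓡 k) 𝓘(ℝ, V →L[ℝ] V) ∞ ρ) :
    HasMFDerivAt (𝓡 k) 𝓘(ℝ, V →L[ℝ] V) ρ 1 (repDeriv k ρ) :=
  (hρs.mdifferentiable (by simp) 1).hasMFDerivAt

/-- Differentiate `⟨ρ a v, ρ a w⟩ = ⟨v, w⟩` at `a = 1`. -/
theorem repDeriv_skew (hρs : ContMDiff (𝓡 k) 𝓘(ℝ, V →L[ℝ] V) ∞ ρ)
    (hρi : ∀ a u v, inner ℝ (ρ a u) (ρ a v) = inner ℝ u v) (X : EuclideanSpace ℝ (Fin k)) (v w : V) :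
    inner ℝ (repDeriv k ρ X v) w = - inner ℝ v (repDeriv k ρ X w) := by
  have h1 : HasFDerivAt (fun T : V →L[ℝ] V => inner ℝ (T v) (T w)) _ (ρ 1) :=
    ((ContinuousLinearMap.apply ℝ V v).hasFDerivAt (x := ρ 1)).inner ℝ
      ((ContinuousLinearMap.apply ℝ V w).hasFDerivAt (x := ρ 1))
  have h2 := h1.hasMFDerivAt.comp (1 : G) (hasMFDerivAt_rep hρs)
  have h3 : (fun T : V →L[ℝ] V => inner ℝ (T v) (T w)) ∘ ρ = fun _ => inner ℝ v w :=
    funext fun a => hρi a v w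
  rw [h3] at h2
  have h4 := hasMFDerivAt_unique h2 (hasMFDerivAt_const _ _)
  have h5 := congrArg (fun T : EuclideanSpace ℝ (Fin k) →L[ℝ] ℝ => T X) h4
  have h6 : inner ℝ (ρ 1 v) (repDeriv k ρ X w) + inner ℝ (repDeriv k ρ X v) (ρ 1 w) = 0 := h5
  rw [map_one] at h6
  have h7 : inner ℝ v (repDeriv k ρ X w) + inner ℝ (repDeriv k ρ X v) w = 0 := h6
  linarith

/-- Differentiate `ρ (b * a * b⁻¹) = ρ b * ρ a * ρ b⁻¹` in `a`; `Y` is the adjoint action of `b` on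
`X`. This makes the space of infinitesimal operators stable under conjugation. -/
theorem exists_repDeriv_conj [LieGroup (𝓡 k) ∞ G] (hρs : ContMDiff (𝓡 k) 𝓘(ℝ, V →L[ℝ] V) ∞ ρ)
    (b : G) (X : EuclideanSpace ℝ (Fin k)) :
    ∃ Y, repDeriv k ρ Y = ρ b * repDeriv k ρ X * ρ b⁻¹ := by
  let κ : G → G := fun a => b * a * b⁻¹
  have hκ : ContMDiff (𝓡 k) (𝓡 k) ∞ κ := (contMDiff_const.mul contMDiff_id).mul contMDiff_const
  let K : EuclideanSpace ℝ (Fin k) →L[ℝ] EuclideanSpace ℝ (Fin k) := mfderiv (𝓡 k) (𝓡 k) κ 1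
  have hK : HasMFDerivAt (𝓡 k) (𝓡 k) κ 1 K := (hκ.mdifferentiable (by simp) 1).hasMFDerivAt
  have hD : HasMFDerivAt (𝓡 k) 𝓘(ℝ, V →L[ℝ] V) ρ (κ 1) (repDeriv k ρ) :=
    (hasMFDerivAt_rep hρs).congr_point (by simp [κ])
  have h1 := hD.comp (1 : G) hK
  let C : (V →L[ℝ] V) →L[ℝ] (V →L[ℝ] V) :=
    (ContinuousLinearMap.mul ℝ (V →L[ℝ] V) (ρ b)).comp
      ((ContinuousLinearMap.mul ℝ (V →L[ℝ] V)).flip (ρ b⁻¹))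
  have hC : ∀ T, C T = ρ b * T * ρ b⁻¹ := fun T => by simp [C, mul_assoc]
  have h2 := (C.hasFDerivAt (x := ρ 1)).hasMFDerivAt.comp (1 : G) (hasMFDerivAt_rep hρs)
  have h3 : ρ ∘ κ = C ∘ ρ := by
    funext a
    simp only [Function.comp, hC, κ, map_mul]
  rw [h3] at h1
  have h4 : (repDeriv k ρ) ∘L K = C ∘L (repDeriv k ρ) := hasMFDerivAt_unique h1 h2
  refine ⟨K X, ?_⟩
  rw [← hC]
  exact congrArg (fun T : EuclideanSpace ℝ (Fin k) →L[ℝ] (V →L[ℝ] V) => T X) h4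

variable [ContMDiffSMul (𝓡 k) (𝓡 m) ∞ G M]

/-- The differential of an equivariant map on the vectors tangent to the orbits. -/
theorem vecDeriv_orbit (hρs : ContMDiff (𝓡 k) 𝓘(ℝ, V →L[ℝ] V) ∞ ρ)
    (hφs : ContMDiff (𝓡 m) 𝓘(ℝ, V) ∞ φ) (hφ : ∀ a x, φ (a • x) = ρ a (φ x)) (p : M)
    (X : EuclideanSpace ℝ (Fin k)) :
    vecDeriv φ p ((mfderiv (𝓡 k) (𝓡 m) (fun a : G => a • p) 1 :
      EuclideanSpace ℝ (Fin k) →L[ℝ] EuclideanSpace ℝ (Fin m)) X) = repDeriv k ρ X (φ p) := by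
  let D : EuclideanSpace ℝ (Fin k) →L[ℝ] EuclideanSpace ℝ (Fin m) :=
    mfderiv (𝓡 k) (𝓡 m) (fun a : G => a • p) 1
  have hD : HasMFDerivAt (𝓡 k) (𝓡 m) (fun a : G => a • p) 1 D :=
    ((contMDiff_smul_right (k := k) p).mdifferentiable (by simp) 1).hasMFDerivAt
  let L : EuclideanSpace ℝ (Fin m) →L[ℝ] V := mfderiv (𝓡 m) 𝓘(ℝ, V) φ p
  have hL : HasMFDerivAt (𝓡 m) 𝓘(ℝ, V) φ ((1 : G) • p) L :=
    HasMFDerivAt.congr_point (one_smul G p).symm (hφs.mdifferentiable (by simp) p).hasMFDerivAt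
  have h1 := hL.comp (1 : G) hD
  have h2 := ((ContinuousLinearMap.apply ℝ V (φ p)).hasFDerivAt (x := ρ 1)).hasMFDerivAt.comp
    (1 : G) (hasMFDerivAt_rep hρs)
  have h3 : φ ∘ (fun a : G => a • p) = ContinuousLinearMap.apply ℝ V (φ p) ∘ ρ :=
    funext fun a => hφ a p
  rw [h3] at h1
  have h4 : L ∘L D = (ContinuousLinearMap.apply ℝ V (φ p)) ∘L (repDeriv k ρ) :=
    hasMFDerivAt_unique h1 h2
  exact congrArg (fun T : EuclideanSpace ℝ (Fin k) →L[ℝ] V => T X) h4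

/-- Equivariant maps are smooth. -/
theorem contMDiff_of_equivariant [IsManifold (𝓡 k) ∞ G] [IsManifold (𝓡 m) ∞ M]
    [MulAction.IsPretransitive G M]
    (hρs : ContMDiff (𝓡 k) 𝓘(ℝ, V →L[ℝ] V) ∞ ρ) (hφ : ∀ a x, φ (a • x) = ρ a (φ x)) (o : M)
    (hsurj : Function.Surjective (mfderiv (𝓡 k) (𝓡 m) (fun a : G => a • o) 1)) :
    ContMDiff (𝓡 m) 𝓘(ℝ, V) ∞ φ := by
  have ho : ContMDiffAt (𝓡 m) 𝓘(ℝ, V) ∞ φ o := by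
    -- A local section `σ` of the orbit map gives `φ x = ρ (σ x) (φ o)` near `o`.
    obtain ⟨σ, hσs, hσ⟩ := exists_local_section (contMDiff_smul_right (k := k) (m := m) o) (1 : G) hsurj
    rw [one_smul] at hσs hσ
    have h1 : ContMDiffAt (𝓡 m) 𝓘(ℝ, V) ∞ (fun x => ρ (σ x) (φ o)) o :=
      ((ContinuousLinearMap.apply ℝ V (φ o)).contDiff.contMDiff.comp hρs).contMDiffAt.comp o hσs
    refine h1.congr_of_eventuallyEq ?_
    filter_upwards [hσ] with x hx
    rw [← hφ, hx]
  intro p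
  obtain ⟨a, ha⟩ := MulAction.exists_smul_eq G p o
  have h1 : ContMDiffAt (𝓡 m) 𝓘(ℝ, V) ∞ (fun x => ρ a⁻¹ (φ (a • x))) p :=
    (ρ a⁻¹).contDiff.contMDiff.contMDiffAt.comp p
      (ContMDiffAt.comp p (g := φ) (ha ▸ ho) (contMDiff_smul_left (k := k) a).contMDiffAt)
  refine h1.congr_of_eventuallyEq (Filter.Eventually.of_forall fun x => ?_)
  simp only [hφ, map_inv_apply_map]

end EquivariantMaps

/-! ### Parseval frames and the trace form. -/

section Frames

/-- Expand each `X a` in an orthonormal basis `e` and exchange the sums: the frame identity leaves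
`∑ B (e i) (e i)`. -/
theorem sum_apply_self_of_frame {W : Type*} [AddCommGroup W] [Module ℝ W] [FiniteDimensional ℝ W]
    (B : W →ₗ[ℝ] W →ₗ[ℝ] ℝ) (hsymm : ∀ v w, B v w = B w v) (hpos : ∀ v, v ≠ 0 → 0 < B v v)
    {d : ℕ} (X : Fin d → W) (hX : ∀ v w, ∑ a, B (X a) v * B (X a) w = B v w) :
    ∑ a, B (X a) (X a) = Module.finrank ℝ W := by
  let core := coreOfPosDef B hsymm hpos
  let : NormedAddCommGroup W := core.toNormedAddCommGroup
  let : InnerProductSpace ℝ W := InnerProductSpace.ofCore core.toCore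
  have hB : ∀ v w, inner ℝ v w = B v w := fun _ _ => rfl
  let e := stdOrthonormalBasis ℝ W
  have h1 : ∀ a, B (X a) (X a) = ∑ i, B (X a) (e i) * B (X a) (e i) := by
    intro a
    have := e.sum_inner_mul_inner (X a) (X a)
    rw [hB] at this
    rw [← this]
    refine Finset.sum_congr rfl fun i _ => ?_
    rw [hB, hB, hsymm (e i)]
  simp only [h1]
  rw [Finset.sum_comm]
  simp only [hX]
  have h2 : ∀ i, B (e i) (e i) = 1 := fun i => by
    rw [← hB, orthonormal_iff_ite.1 e.orthonormal, if_pos rfl]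
  simp [h2]

variable {V : Type*} [NormedAddCommGroup V] [InnerProductSpace ℝ V] [FiniteDimensional ℝ V]

/-- An orthonormal basis of a space of skew-symmetric maps for the trace form. -/
theorem exists_trace_frame (K : Submodule ℝ (V →L[ℝ] V))
    (hK : ∀ T ∈ K, ∀ v w, inner ℝ (T v) w = - inner ℝ v (T w)) :
    ∃ (d : ℕ) (A : Fin d → V →L[ℝ] V), Submodule.span ℝ (Set.range A) = K ∧
      ∀ R R' : V →L[ℝ] V, R' * R = 1 → (∀ T ∈ K, R * T * R' ∈ K) →
        ∀ β : (V →L[ℝ] V) →ₗ[ℝ] (V →L[ℝ] V) →ₗ[ℝ] ℝ,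
          ∑ a, β (R * A a * R') (R * A a * R') = ∑ a, β (A a) (A a) := by
  let tr : (V →L[ℝ] V) →ₗ[ℝ] ℝ := LinearMap.trace ℝ V ∘ₗ ContinuousLinearMap.coeLM ℝ
  have htr : ∀ S T : V →L[ℝ] V, tr (S * T) = tr (T * S) := fun S T =>
    LinearMap.trace_mul_comm ℝ (S : V →ₗ[ℝ] V) (T : V →ₗ[ℝ] V)
  let b := stdOrthonormalBasis ℝ V
  have htrb : ∀ T : V →L[ℝ] V, tr T = ∑ i, inner ℝ (b i) (T (b i)) := fun T =>
    LinearMap.trace_eq_sum_inner (T : V →ₗ[ℝ] V) b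
  let B : K →ₗ[ℝ] K →ₗ[ℝ] ℝ := LinearMap.mk₂ ℝ (fun S T => - tr ((S : V →L[ℝ] V) * T))
    (fun S S' T => by simp [add_mul]; ring) (fun r S T => by simp)
    (fun S S' T => by simp [mul_add]; ring) (fun r S T => by simp)
  have hB : ∀ S T : K, B S T = - tr ((S : V →L[ℝ] V) * T) := fun _ _ => rfl
  -- For a skew map, `-tr (S * S)` is the sum of the squared norms `‖S (b i)‖²`.
  have hBpos : ∀ S : K, S ≠ 0 → 0 < B S S := by
    intro S hS
    have h1 : B S S = ∑ i, ‖(S : V →L[ℝ] V) (b i)‖ ^ 2 := by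
      rw [hB, htrb, ← Finset.sum_neg_distrib]
      refine Finset.sum_congr rfl fun i _ => ?_
      rw [mul_apply_eq_comp, ← hK _ S.2, real_inner_self_eq_norm_sq]
    rw [h1]
    refine lt_of_le_of_ne (Finset.sum_nonneg fun i _ => sq_nonneg _) fun h0 => hS ?_
    have h2 := (Finset.sum_eq_zero_iff_of_nonneg fun i _ => sq_nonneg _).1 h0.symm
    have h3 : ((S : V →L[ℝ] V) : V →ₗ[ℝ] V) = 0 := b.toBasis.ext fun i => by
      simpa using h2 i (Finset.mem_univ i)
    apply Subtype.ext
    ext v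
    exact LinearMap.congr_fun h3 v
  obtain ⟨d, e, hspan, he⟩ := exists_invariant_frame B (fun S T => by rw [hB, hB, htr]) hBpos
  refine ⟨d, fun a => e a, ?_, fun R R' hRR hR β => ?_⟩
  · have : Set.range (fun a => (e a : V →L[ℝ] V)) = K.subtype '' Set.range e := by
      rw [← Set.range_comp]; rfl
    rw [this, Submodule.span_image, hspan, Submodule.map_top, Submodule.range_subtype]
  -- Conjugation preserves the trace form, so the invariance of the frame applies to it.
  · let C : K →ₗ[ℝ] K :=
      { toFun := fun T => ⟨R * T * R', hR T T.2⟩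
        map_add' := fun S T => Subtype.ext (by simp [mul_add, add_mul])
        map_smul' := fun r T => Subtype.ext (by simp) }
    have hC : ∀ T : K, (C T : V →L[ℝ] V) = R * T * R' := fun _ => rfl
    have h1 := he C (fun S T => by
      rw [hB, hB, hC, hC]
      have : R * (S : V →L[ℝ] V) * R' * (R * T * R') = R * (S * T * R') := by
        simp only [mul_assoc]
        rw [← mul_assoc R' R, hRR, one_mul]
      rw [this, htr, mul_assoc, hRR, mul_one]) (β.compl₁₂ K.subtype K.subtype)
    simpa [hC] using h1

end Frames

/-! ### Equivariant maps are homothetic. -/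

section Homothety

variable {m k : ℕ} {M : Type*} [TopologicalSpace M] [ChartedSpace (EuclideanSpace ℝ (Fin m)) M]
  [IsManifold (𝓡 m) ∞ M] {g : RiemMetric m M}
  {G : Type*} [Group G] [MulAction G M] [MulAction.IsPretransitive G M]
  {V : Type*} [NormedAddCommGroup V] [InnerProductSpace ℝ V] {ρ : G →* (V →L[ℝ] V)} {φ : M → V}

/-- Nonconstant equivariant maps of an isotropy irreducible homogeneous space are homothetic. -/
theorem exists_homothety [ConnectedSpace M] (hm : 0 < m)
    (hG : ∀ a : G, ContMDiff (𝓡 m) (𝓡 m) ∞ (fun x : M => a • x)) (hisom : ActsByIsometries G g)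
    (o : M) (hirr : IsotropyIrreducible m G o)
    (hρi : ∀ a u v, inner ℝ (ρ a u) (ρ a v) = inner ℝ u v)
    (hφs : ContMDiff (𝓡 m) 𝓘(ℝ, V) ∞ φ) (hφ : ∀ a x, φ (a • x) = ρ a (φ x))
    (hnc : ¬ ∀ x y, φ x = φ y) :
    ∃ c : ℝ, 0 < c ∧ ∀ p v w, inner ℝ (vecDeriv φ p v) (vecDeriv φ p w) = c * g.inner p v w := by
  let q : ∀ p : M, TangentSpace (𝓡 m) p →ₗ[ℝ] TangentSpace (𝓡 m) p →ₗ[ℝ] ℝ := fun p =>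
    LinearMap.mk₂ ℝ (fun v w => inner ℝ (vecDeriv φ p v) (vecDeriv φ p w))
      (fun v v' w => by simp only [vecDeriv, map_add]; exact inner_add_left _ _ _)
      (fun r v w => by simp only [vecDeriv, map_smul]; exact real_inner_smul_left _ _ _)
      (fun v w w' => by simp only [vecDeriv, map_add]; exact inner_add_right _ _ _)
      (fun r v w => by simp only [vecDeriv, map_smul]; exact real_inner_smul_right _ _ _)
  obtain ⟨c, hc⟩ := invariant_form_eq hisom o hirr q (fun p v w => real_inner_comm _ _)
    (fun a p v w => by
      simp only [q, LinearMap.mk₂_apply]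
      rw [vecDeriv_smul a (hG a) hφs hφ, vecDeriv_smul a (hG a) hφs hφ, hρi])
  have hc' : ∀ p v w, inner ℝ (vecDeriv φ p v) (vecDeriv φ p w) = c * g.inner p v w := hc
  refine ⟨c, lt_of_le_of_ne ?_ fun h0 => hnc ?_, hc'⟩
  · let v : EuclideanSpace ℝ (Fin m) := EuclideanSpace.single ⟨0, hm⟩ 1
    have hv : v ≠ 0 := by simp [v]
    have h1 := hc' o v v
    have h2 : 0 < g.inner o v v := g.pos o v hv
    have h3 : 0 ≤ c * g.inner o v v := by
      rw [← h1]
      exact real_inner_self_nonneg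
    exact nonneg_of_mul_nonneg_left h3 h2
  · have h1 : ∀ p, mfderiv (𝓡 m) 𝓘(ℝ, V) φ p = 0 := by
      intro p
      ext1 v
      have := hc' p v v
      rw [← h0, zero_mul] at this
      have h : vecDeriv φ p v = 0 := inner_self_eq_zero.1 this
      exact h
    have h2 := isLocallyConstant_of_mfderiv_eq_zero (hφs.mdifferentiable (by simp)) h1
    exact fun x y => h2.apply_eq_of_preconnectedSpace x y

end Homothety

/-! ### The Laplacian on a homothetically immersed manifold. -/

section LaplacianOfHomothety

variable {m : ℕ} {M : Type*} [TopologicalSpace M] [ChartedSpace (EuclideanSpace ℝ (Fin m)) M]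
  [IsManifold (𝓡 m) ∞ M] {g : RiemMetric m M}
  {V : Type*} [NormedAddCommGroup V] [InnerProductSpace ℝ V] {φ : M → V}

theorem RiemMetric.gram_det_pos (g : RiemMetric m M) (p : M) {y : EuclideanSpace ℝ (Fin m)}
    (hy : y ∈ (extChartAt (𝓡 m) p).target) : 0 < (g.gram p y).det := by
  have : IsManifold (𝓡 m) 1 M := IsManifold.of_le (n := ∞) (by simp)
  set q := (extChartAt (𝓡 m) p).symm y with hq
  let L : EuclideanSpace ℝ (Fin m) →L[ℝ] TangentSpace (𝓡 m) q :=
    mfderiv (𝓡 m) (𝓡 m) (extChartAt (𝓡 m) p).symm y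
  have hL : Function.Injective L := by
    obtain ⟨e, he⟩ := isInvertible_mfderiv_extChartAt_symm hy
    have : ∀ x, L x = e x := fun x => congrArg (fun T => T x) he.symm
    intro x x' hx
    rw [this, this] at hx
    exact e.injective hx
  refine Matrix.PosDef.det_pos (Matrix.PosDef.of_dotProduct_mulVec_pos ?_ fun x hx => ?_)
  · ext i j
    simp only [Matrix.conjTranspose_apply, RiemMetric.gram, Matrix.of_apply, star_trivial]
    exact g.symm _ _ _
  · have hsum : L (WithLp.toLp 2 x) = ∑ i, x i • coordVec p y i := by
      have h1 : (WithLp.toLp 2 x : EuclideanSpace ℝ (Fin m)) =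
          ∑ i, x i • EuclideanSpace.single i (1 : ℝ) := by
        simpa using ((EuclideanSpace.basisFun (Fin m) ℝ).sum_repr (WithLp.toLp 2 x)).symm
      rw [h1, map_sum]
      refine Finset.sum_congr rfl fun i _ => ?_
      rw [map_smul]
      rfl
    have hne : L (WithLp.toLp 2 x) ≠ 0 := by
      intro h0
      have := hL (h0.trans (map_zero L).symm)
      exact hx (by simpa using congrArg WithLp.ofLp this)
    have h2 := g.pos q _ hne
    refine lt_of_lt_of_eq h2 ?_
    rw [hsum]
    simp only [star_trivial, dotProduct, Matrix.mulVec, RiemMetric.gram, Matrix.of_apply, map_sum,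
      map_smul, sum_apply, Finset.mul_sum, smul_apply, smul_eq_mul]
    rw [Finset.sum_comm]
    refine Finset.sum_congr rfl fun i _ => Finset.sum_congr rfl fun j _ => ?_
    ring

/-- The Laplacian of the linear functionals on a homothetically immersed manifold whose metric is
dual to a family of vector fields induced by skew-symmetric maps. -/
theorem laplaceBeltrami_of_frame (hφs : ContMDiff (𝓡 m) 𝓘(ℝ, V) ∞ φ) {c : ℝ} (hc : 0 < c)
    (hg : ∀ p v w, inner ℝ (vecDeriv φ p v) (vecDeriv φ p w) = c * g.inner p v w)
    {d : ℕ} {A : Fin d → V →L[ℝ] V} (hA : ∀ a v w, inner ℝ (A a v) w = - inner ℝ v (A a w))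
    (htan : ∀ a p, ∃ x : TangentSpace (𝓡 m) p, vecDeriv φ p x = A a (φ p))
    (hframe : ∀ p v w, ∑ a, inner ℝ (A a (φ p)) (vecDeriv φ p v) *
      inner ℝ (A a (φ p)) (vecDeriv φ p w) = c * (c * g.inner p v w)) (u : V) (p : M) :
    g.laplaceBeltrami (fun x => inner ℝ (φ x) u) p = ∑ a, inner ℝ (A a (A a (φ p))) u := by
  have : IsManifold (𝓡 m) 1 M := IsManifold.of_le (n := ∞) (by simp)
  set e := extChartAt (𝓡 m) p with he
  have hep : e.symm (e p) = p := e.left_inv (mem_extChartAt_source p)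
  have hes : ∀ y ∈ e.target, MDifferentiableAt (𝓡 m) (𝓡 m) e.symm y := fun y hy =>
    (contMDiffAt_extChartAt_symm hy).mdifferentiableAt (by simp)
  have hder : ∀ y ∈ e.target, ∀ v : EuclideanSpace ℝ (Fin m), fderiv ℝ (φ ∘ e.symm) y v =
      vecDeriv φ (e.symm y) (mfderiv (𝓡 m) (𝓡 m) e.symm y v) := by
    intro y hy v
    have h1 := (hφs.mdifferentiable (by simp) (e.symm y)).hasMFDerivAt.comp y (hes y hy).hasMFDerivAt
    let L : EuclideanSpace ℝ (Fin m) →L[ℝ] V :=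
      (mfderiv (𝓡 m) 𝓘(ℝ, V) φ (e.symm y) : EuclideanSpace ℝ (Fin m) →L[ℝ] V).comp
        (mfderiv (𝓡 m) (𝓡 m) e.symm y : EuclideanSpace ℝ (Fin m) →L[ℝ] EuclideanSpace ℝ (Fin m))
    have h2 : HasFDerivAt (φ ∘ e.symm) L y := HasMFDerivAt.hasFDerivAt h1
    exact congrArg (fun T : EuclideanSpace ℝ (Fin m) →L[ℝ] V => T v) h2.fderiv
  have hΨ : ContDiffOn ℝ ∞ (φ ∘ e.symm) e.target := by
    rw [← contMDiffOn_iff_contDiffOn]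
    exact hφs.comp_contMDiffOn (contMDiffOn_extChartAt_symm p)
  have key := laplacian_of_killing_frame (isOpen_extChartAt_target p)
    (mem_extChartAt_target (I := 𝓡 m) p) hΨ (P := g.gram p) hc.ne'
    (fun y hy i j => by
      rw [hder y hy, hder y hy, hg]
      rfl)
    (fun y hy => g.gram_det_pos p hy) hA
    (fun a y hy => by
      obtain ⟨x, hx⟩ := htan a (e.symm y)
      obtain ⟨E, hE⟩ := isInvertible_mfderiv_extChartAt_symm hy
      obtain ⟨v, hv⟩ : ∃ v : EuclideanSpace ℝ (Fin m), E v = x := E.surjective x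
      refine ⟨v, (hder y hy v).trans (Eq.trans ?_ hx)⟩
      rw [← hE]
      exact congrArg (vecDeriv φ (e.symm y)) hv)
    (fun y hy v w => by
      simp only [hder y hy]
      rw [hg]
      exact hframe _ _ _) u
  have h3 : (φ ∘ e.symm) (e p) = φ p := congrArg φ hep
  rw [← h3]
  exact key

/-- The vectors `X a` with `dφ (X a) = A a (φ p)` form a Parseval frame for `g`, so their squared
lengths add up to `m`, and `dφ` multiplies squared lengths by `c`. -/
theorem sum_norm_sq_of_frame {c : ℝ} (hc : 0 < c)
    (hg : ∀ p v w, inner ℝ (vecDeriv φ p v) (vecDeriv φ p w) = c * g.inner p v w)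
    {d : ℕ} {A : Fin d → V →L[ℝ] V}
    (htan : ∀ a p, ∃ x : TangentSpace (𝓡 m) p, vecDeriv φ p x = A a (φ p))
    (hframe : ∀ p v w, ∑ a, inner ℝ (A a (φ p)) (vecDeriv φ p v) *
      inner ℝ (A a (φ p)) (vecDeriv φ p w) = c * (c * g.inner p v w)) (p : M) :
    ∑ a, inner ℝ (A a (φ p)) (A a (φ p)) = c * m := by
  have hfin : FiniteDimensional ℝ (TangentSpace (𝓡 m) p) :=
    inferInstanceAs (FiniteDimensional ℝ (EuclideanSpace ℝ (Fin m)))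
  let B : TangentSpace (𝓡 m) p →ₗ[ℝ] TangentSpace (𝓡 m) p →ₗ[ℝ] ℝ :=
    LinearMap.mk₂ ℝ (fun v w => g.inner p v w) (by simp) (by simp) (by simp) (by simp)
  have hB : ∀ v w, B v w = g.inner p v w := fun _ _ => rfl
  choose X hX using fun a => htan a p
  have h1 := sum_apply_self_of_frame B (fun v w => g.symm p v w) (fun v hv => g.pos p v hv) X
    (fun v w => by
      have := hframe p v w
      simp only [← hX, hg] at this
      have h2 : ∀ a, c * g.inner p (X a) v * (c * g.inner p (X a) w) =
          c * (c * (B (X a) v * B (X a) w)) := fun a => by rw [hB, hB]; ring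
      simp only [h2, ← Finset.mul_sum] at this
      exact mul_left_cancel₀ hc.ne' (mul_left_cancel₀ hc.ne' this))
  have h2 : Module.finrank ℝ (TangentSpace (𝓡 m) p) = m := finrank_euclideanSpace_fin
  rw [h2] at h1
  simp only [← hX, hg]
  rw [← Finset.mul_sum]
  exact congrArg (c * ·) h1

end LaplacianOfHomothety

/-! ### The Laplacian as a sum of squares of infinitesimal operators. -/

section Casimir

variable {m k : ℕ} {M : Type*} [TopologicalSpace M] [ChartedSpace (EuclideanSpace ℝ (Fin m)) M]
  [IsManifold (𝓡 m) ∞ M] {g : RiemMetric m M}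
  {G : Type*} [TopologicalSpace G] [ChartedSpace (EuclideanSpace ℝ (Fin k)) G]
  [Group G] [LieGroup (𝓡 k) ∞ G] [MulAction G M] [MulAction.IsPretransitive G M]
  [ContMDiffSMul (𝓡 k) (𝓡 m) ∞ G M]
  {V : Type*} [NormedAddCommGroup V] [InnerProductSpace ℝ V] [FiniteDimensional ℝ V]
  {ρ : G →* (V →L[ℝ] V)} {φ : M → V}

/-- The frame of Killing fields dual to the metric of an isotropy irreducible homogeneous space. -/
theorem exists_killing_frame (hm : 0 < m) (hisom : ActsByIsometries G g) (o : M)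
    (hirr : IsotropyIrreducible m G o)
    (hsurj : Function.Surjective (mfderiv (𝓡 k) (𝓡 m) (fun a : G => a • o) 1))
    (hρs : ContMDiff (𝓡 k) 𝓘(ℝ, V →L[ℝ] V) ∞ ρ)
    (hρi : ∀ a u v, inner ℝ (ρ a u) (ρ a v) = inner ℝ u v)
    (hφs : ContMDiff (𝓡 m) 𝓘(ℝ, V) ∞ φ) (hφ : ∀ a x, φ (a • x) = ρ a (φ x))
    {c : ℝ} (hc : 0 < c)
    (hg : ∀ p v w, inner ℝ (vecDeriv φ p v) (vecDeriv φ p w) = c * g.inner p v w) :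
    ∃ (d : ℕ) (A : Fin d → V →L[ℝ] V), (∀ a v w, inner ℝ (A a v) w = - inner ℝ v (A a w)) ∧
      (∀ a p, ∃ x : TangentSpace (𝓡 m) p, vecDeriv φ p x = A a (φ p)) ∧
      (∀ p v w, ∑ a, inner ℝ (A a (φ p)) (vecDeriv φ p v) *
        inner ℝ (A a (φ p)) (vecDeriv φ p w) = c * (c * g.inner p v w)) ∧
      ∀ (b : G) (u w : V), ∑ a, inner ℝ (A a (A a (ρ b u))) w =
        ∑ a, inner ℝ (ρ b (A a (A a u))) w := by
  let K : Submodule ℝ (V →L[ℝ] V) :=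
    LinearMap.range (repDeriv k ρ : EuclideanSpace ℝ (Fin k) →ₗ[ℝ] (V →L[ℝ] V))
  have hKskew : ∀ T ∈ K, ∀ v w, inner ℝ (T v) w = - inner ℝ v (T w) := by
    rintro _ ⟨X, rfl⟩ v w
    exact repDeriv_skew hρs hρi X v w
  have hKtan : ∀ T ∈ K, ∀ p, ∃ x : TangentSpace (𝓡 m) p, vecDeriv φ p x = T (φ p) := by
    rintro _ ⟨X, rfl⟩ p
    exact ⟨_, vecDeriv_orbit hρs hφs hφ p X⟩
  have hKo : ∀ v : TangentSpace (𝓡 m) o, ∃ T ∈ K, vecDeriv φ o v = T (φ o) := by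
    intro v
    obtain ⟨v, rfl⟩ : ∃ v', v = v' := ⟨v, rfl⟩
    have : ∃ X : EuclideanSpace ℝ (Fin k), (mfderiv (𝓡 k) (𝓡 m) (fun a : G => a • o) 1 :
      EuclideanSpace ℝ (Fin k) →L[ℝ] EuclideanSpace ℝ (Fin m)) X = v := by
      have := hsurj
      rw [show ((1 : G) • o) = o from one_smul G o] at this
      exact this v
    obtain ⟨X, hX⟩ := this
    refine ⟨repDeriv k ρ X, ⟨X, rfl⟩, ?_⟩
    rw [← vecDeriv_orbit hρs hφs hφ o X, hX]
  have hKconj : ∀ b : G, ∀ T ∈ K, ρ b * T * ρ b⁻¹ ∈ K := by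
    rintro b _ ⟨X, rfl⟩
    exact exists_repDeriv_conj hρs b X
  have hinvmul : ∀ b : G, ρ b⁻¹ * ρ b = 1 := fun b => by
    rw [← map_mul, inv_mul_cancel, map_one]
  obtain ⟨d, A, hspan, hAinv⟩ := exists_trace_frame K hKskew
  have hAK : ∀ a, A a ∈ K := fun a => hspan ▸ Submodule.subset_span ⟨a, rfl⟩
  let q : ∀ p : M, TangentSpace (𝓡 m) p →ₗ[ℝ] TangentSpace (𝓡 m) p →ₗ[ℝ] ℝ := fun p =>
    LinearMap.mk₂ ℝ (fun v w => ∑ a, inner ℝ (A a (φ p)) (vecDeriv φ p v) *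
        inner ℝ (A a (φ p)) (vecDeriv φ p w))
      (fun v v' w => by
        rw [← Finset.sum_add_distrib]
        refine Finset.sum_congr rfl fun a _ => ?_
        rw [← add_mul, ← inner_add_right]
        simp only [vecDeriv, map_add]; rfl)
      (fun r v w => by
        rw [smul_eq_mul, Finset.mul_sum]
        refine Finset.sum_congr rfl fun a _ => ?_
        have h : vecDeriv φ p (r • v) = r • vecDeriv φ p v := map_smul _ _ _
        rw [h, real_inner_smul_right, mul_assoc])
      (fun v w w' => by
        rw [← Finset.sum_add_distrib]
        refine Finset.sum_congr rfl fun a _ => ?_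
        rw [← mul_add, ← inner_add_right]
        simp only [vecDeriv, map_add]; rfl)
      (fun r v w => by
        rw [smul_eq_mul, Finset.mul_sum]
        refine Finset.sum_congr rfl fun a _ => ?_
        have h : vecDeriv φ p (r • w) = r • vecDeriv φ p w := map_smul _ _ _
        rw [h, real_inner_smul_right, mul_left_comm])
  have hq : ∀ p v w, q p v w = ∑ a, inner ℝ (A a (φ p)) (vecDeriv φ p v) *
        inner ℝ (A a (φ p)) (vecDeriv φ p w) := fun _ _ _ => rfl
  obtain ⟨κ, hκ⟩ := invariant_form_eq hisom o hirr q
    (fun p v w => by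
      rw [hq, hq]
      exact Finset.sum_congr rfl fun a _ => mul_comm _ _)
    -- Moving `ρ b` across the inner product conjugates each `A a` by `ρ b⁻¹`, and the frame sum is
    -- unchanged by this.
    (fun b p v w => by
      rw [hq, hq]
      simp only [vecDeriv_smul b (contMDiff_smul_left (k := k) b) hφs hφ]
      let ev : V → (V →L[ℝ] V) →ₗ[ℝ] ℝ := fun z =>
        (innerₛₗ ℝ z) ∘ₗ (ContinuousLinearMap.apply ℝ V (φ p)).toLinearMap
      have hev : ∀ z T, ev z T = inner ℝ (T (φ p)) z := fun z T => real_inner_comm _ _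
      let β : (V →L[ℝ] V) →ₗ[ℝ] (V →L[ℝ] V) →ₗ[ℝ] ℝ :=
        (LinearMap.mul ℝ ℝ).compl₁₂ (ev (vecDeriv φ p v)) (ev (vecDeriv φ p w))
      have hβ : ∀ S T, β S T = inner ℝ (S (φ p)) (vecDeriv φ p v) *
        inner ℝ (T (φ p)) (vecDeriv φ p w) := fun S T => by
          rw [← hev, ← hev]; rfl
      have h1 := hAinv (ρ b⁻¹) (ρ b) (by simpa using hinvmul b⁻¹)
        (fun T hT => by simpa using hKconj b⁻¹ T hT) β
      simp only [hβ] at h1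
      rw [← h1]
      refine Finset.sum_congr rfl fun a _ => ?_
      have h2 : ∀ z, inner ℝ (A a (φ (b • p))) (ρ b z) =
          inner ℝ ((ρ b⁻¹ * A a * ρ b) (φ p)) z := fun z => by
        rw [← hρi b ((ρ b⁻¹ * A a * ρ b) (φ p)), hφ]
        simp only [mul_apply_eq_comp]
        rw [← mul_apply_eq_comp (ρ b) (ρ b⁻¹), ← map_mul, mul_inv_cancel, map_one]
        rfl
      rw [h2, h2])
  have hκ' : ∀ p v w, ∑ a, inner ℝ (A a (φ p)) (vecDeriv φ p v) *
        inner ℝ (A a (φ p)) (vecDeriv φ p w) = κ * g.inner p v w := hκ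
  let v₀ : TangentSpace (𝓡 m) o := (EuclideanSpace.single ⟨0, hm⟩ 1 : EuclideanSpace ℝ (Fin m))
  have hv₀ : v₀ ≠ 0 := by
    have : (EuclideanSpace.single ⟨0, hm⟩ 1 : EuclideanSpace ℝ (Fin m)) ≠ 0 := by simp
    exact this
  have hgv₀ := g.pos o v₀ hv₀
  have hκpos : 0 < κ := by
    refine lt_of_le_of_ne ?_ fun h0 => ?_
    · refine nonneg_of_mul_nonneg_left ?_ hgv₀
      rw [← hκ' o v₀ v₀]
      exact Finset.sum_nonneg fun a _ => mul_self_nonneg _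
    -- If `κ = 0`, then `dφ v₀` is orthogonal to `T (φ o)` for all `T ∈ K`. But `dφ v₀` is itself of
    -- this form, because the orbit map is a submersion, and it is not zero.
    · have h1 : ∀ v : TangentSpace (𝓡 m) o, ∀ a, inner ℝ (A a (φ o)) (vecDeriv φ o v) = 0 := by
        intro v a
        have := hκ' o v v
        rw [← h0, zero_mul] at this
        have h2 := (Finset.sum_eq_zero_iff_of_nonneg fun a _ => mul_self_nonneg _).1 this a
          (Finset.mem_univ a)
        exact mul_self_eq_zero.1 h2
      obtain ⟨T, hT, hTv⟩ := hKo v₀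
      have h2 : ∀ T ∈ K, inner ℝ (T (φ o)) (vecDeriv φ o v₀) = 0 := by
        intro T hT
        rw [← hspan] at hT
        induction hT using Submodule.span_induction with
        | mem T hT =>
          obtain ⟨a, rfl⟩ := hT
          exact h1 v₀ a
        | zero => simp
        | add S T _ _ hS hT => rw [add_apply, inner_add_left, hS, hT, add_zero]
        | smul r T _ hT => rw [smul_apply, real_inner_smul_left, hT, mul_zero]
      have h3 := h2 T hT
      rw [← hTv, hg] at h3
      exact (mul_pos hc hgv₀).ne' h3
  -- The frame sum is quadratic in `A`, so this scaling turns the factor `κ` into `c * c`.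
  set r : ℝ := √(c * c / κ) with hr
  have hrr : r * r = c * c / κ := Real.mul_self_sqrt (by positivity)
  refine ⟨d, fun a => r • A a, fun a v w => ?_, fun a p => ?_, fun p v w => ?_, fun b u w => ?_⟩
  · rw [smul_apply, smul_apply, real_inner_smul_left, real_inner_smul_right, hKskew _ (hAK a)]
    ring
  · exact hKtan _ (K.smul_mem r (hAK a)) p
  · have h1 : ∀ a, inner ℝ ((r • A a) (φ p)) (vecDeriv φ p v) *
        inner ℝ ((r • A a) (φ p)) (vecDeriv φ p w) = (r * r) *
        (inner ℝ (A a (φ p)) (vecDeriv φ p v) * inner ℝ (A a (φ p)) (vecDeriv φ p w)) := fun a => by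
      rw [smul_apply, real_inner_smul_left, real_inner_smul_left]
      ring
    simp only [h1]
    rw [← Finset.mul_sum, hκ', hrr]
    field_simp
  · have h1 : ∀ (a : Fin d) (u : V), (r • A a) ((r • A a) u) = (r * r) • A a (A a u) := fun a u => by
      simp only [smul_apply, map_smul, smul_smul]
    simp only [h1, map_smul, real_inner_smul_left]
    rw [← Finset.mul_sum, ← Finset.mul_sum]
    congr 1
    let β : (V →L[ℝ] V) →ₗ[ℝ] (V →L[ℝ] V) →ₗ[ℝ] ℝ :=
      LinearMap.mk₂ ℝ (fun S T => inner ℝ (S (T (ρ b u))) w)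
        (fun S S' T => by simp [inner_add_left]) (fun r S T => by simp [real_inner_smul_left])
        (fun S S' T => by simp [inner_add_left]) (fun r S T => by simp [real_inner_smul_left])
    have hβ : ∀ S T, β S T = inner ℝ (S (T (ρ b u))) w := fun _ _ => rfl
    have h2 := hAinv (ρ b) (ρ b⁻¹) (hinvmul b) (hKconj b) β
    simp only [hβ] at h2
    rw [← h2]
    refine Finset.sum_congr rfl fun a _ => ?_
    simp only [mul_apply_eq_comp, map_inv_apply_map]

/-- The Laplacian on the functions given by an equivariant map to a representation. -/
theorem exists_casimir (hm : 0 < m) (hisom : ActsByIsometries G g) (o : M)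
    (hirr : IsotropyIrreducible m G o)
    (hsurj : Function.Surjective (mfderiv (𝓡 k) (𝓡 m) (fun a : G => a • o) 1))
    (hρs : ContMDiff (𝓡 k) 𝓘(ℝ, V →L[ℝ] V) ∞ ρ)
    (hρi : ∀ a u v, inner ℝ (ρ a u) (ρ a v) = inner ℝ u v)
    (hφs : ContMDiff (𝓡 m) 𝓘(ℝ, V) ∞ φ) (hφ : ∀ a x, φ (a • x) = ρ a (φ x))
    {c : ℝ} (hc : 0 < c)
    (hg : ∀ p v w, inner ℝ (vecDeriv φ p v) (vecDeriv φ p w) = c * g.inner p v w) :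
    ∃ C : V →ₗ[ℝ] V, C.IsSymmetric ∧ (∀ a u, C (ρ a u) = ρ a (C u)) ∧
      (∀ u p, g.laplaceBeltrami (fun x => inner ℝ (φ x) u) p = inner ℝ (φ p) (C u)) ∧
      ∀ p, inner ℝ (φ p) (C (φ p)) = - (c * m) := by
  obtain ⟨d, A, hA, htan, hframe, hcomm⟩ :=
    exists_killing_frame hm hisom o hirr hsurj hρs hρi hφs hφ hc hg
  let C : V →ₗ[ℝ] V := ∑ a, ((A a * A a : V →L[ℝ] V) : V →ₗ[ℝ] V)
  have hC : ∀ u, C u = ∑ a, A a (A a u) := fun u => by simp [C]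
  have hsymm : ∀ u w, inner ℝ (C u) w = inner ℝ u (C w) := fun u w => by
    rw [hC, hC, sum_inner, inner_sum]
    refine Finset.sum_congr rfl fun a _ => ?_
    rw [hA, hA, neg_neg]
  -- Commutation with `ρ` is what makes the eigenspaces of `C` invariant.
  refine ⟨C, hsymm, fun b u => ?_, fun u p => ?_, fun p => ?_⟩
  · refine ext_inner_right ℝ fun w => ?_
    have := hcomm b u w
    rwa [← sum_inner, ← sum_inner, ← hC, ← map_sum, ← hC] at this
  · rw [laplaceBeltrami_of_frame hφs hc hg hA htan hframe, ← hsymm, hC, sum_inner]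
  · rw [hC, inner_sum, ← sum_norm_sq_of_frame hc hg htan hframe p, ← Finset.sum_neg_distrib]
    refine Finset.sum_congr rfl fun a _ => ?_
    rw [hA, neg_neg]

end Casimir

/-! ### Scaling factors, traces and decompositions. -/

section HomotheticEvaluation

variable {m : ℕ} {M : Type*} [TopologicalSpace M] [ChartedSpace (EuclideanSpace ℝ (Fin m)) M]
  [IsManifold (𝓡 m) ∞ M] [MeasurableSpace M]

/-- The evaluation map `φ` of `E` is smooth, of constant norm and homothetic with the squared
factor `c`, and the operator `C` of `E` is the Laplacian. -/
structure IsHomotheticEvaluation (g : RiemMetric m M) (μ : Measure M) (E : Submodule ℝ (Lp ℝ 2 μ))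
    (φ : M → E) (c : ℝ) (C : E →ₗ[ℝ] E) : Prop where
  smooth : ContMDiff (𝓡 m) 𝓘(ℝ, E) ∞ φ
  ae_eq : ∀ u : E, (u : Lp ℝ 2 μ) =ᵐ[μ] fun x => inner ℝ (φ x) u
  norm_sq : ∀ p, ‖φ p‖ ^ 2 = Module.finrank ℝ E
  pos : 0 < c
  metric : ∀ p v w, inner ℝ (vecDeriv φ p v) (vecDeriv φ p w) = c * g.inner p v w
  laplacian : ∀ u p, g.laplaceBeltrami (fun x => inner ℝ (φ x) u) p = inner ℝ (φ p) (C u)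
  symmetric : C.IsSymmetric
  trace : LinearMap.trace ℝ E C = -(c * m)

theorem Submodule.finrank_cast_pos {V : Type*} [AddCommGroup V] [Module ℝ V] {E : Submodule ℝ V}
    [FiniteDimensional ℝ E] (hE : E ≠ ⊥) : (0 : ℝ) < Module.finrank ℝ E := by
  have : Nontrivial E := Submodule.nontrivial_iff_ne_bot.2 hE
  exact_mod_cast Module.finrank_pos

namespace IsHomotheticEvaluation

variable {g : RiemMetric m M} {μ : Measure M} {E : Submodule ℝ (Lp ℝ 2 μ)} {φ : M → E} {c : ℝ}
  {C : E →ₗ[ℝ] E}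

theorem contMDiff_inner (h : IsHomotheticEvaluation g μ E φ c C) (u : E) :
    ContMDiff (𝓡 m) 𝓘(ℝ, ℝ) ∞ fun x => inner ℝ (φ x) u :=
  ((innerSL ℝ).flip u).contDiff.contMDiff.comp h.smooth

theorem isEvaluationMap (h : IsHomotheticEvaluation g μ E φ c C) : IsEvaluationMap μ E φ :=
  fun u => ⟨_, (h.contMDiff_inner u).continuous, h.ae_eq u, fun _ => rfl⟩

theorem norm_vecDeriv (h : IsHomotheticEvaluation g μ E φ c C) (p : M)
    (v : TangentSpace (𝓡 m) p) : ‖vecDeriv φ p v‖ = √c * g.tangentNorm p v := by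
  rw [norm_eq_sqrt_real_inner, h.metric, Real.sqrt_mul h.pos.le]
  rfl

theorem unitMap_eq (h : IsHomotheticEvaluation g μ E φ c C) :
    unitMap φ = (√(Module.finrank ℝ E : ℝ))⁻¹ • φ := by
  funext p
  rw [unitMap, Pi.smul_apply, ← h.norm_sq p, Real.sqrt_sq (norm_nonneg _)]

theorem norm_vecDeriv_unitMap (h : IsHomotheticEvaluation g μ E φ c C) (p : M)
    (v : TangentSpace (𝓡 m) p) :
    ‖vecDeriv (unitMap φ) p v‖ = √(c / Module.finrank ℝ E) * g.tangentNorm p v := by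
  have h1 : vecDeriv (unitMap φ) p v = (√(Module.finrank ℝ E : ℝ))⁻¹ • vecDeriv φ p v := by
    rw [h.unitMap_eq]
    have h2 := ((h.smooth.mdifferentiable (by simp) p).hasMFDerivAt.const_smul
      (√(Module.finrank ℝ E : ℝ))⁻¹).mfderiv
    exact congrArg (fun T : EuclideanSpace ℝ (Fin m) →L[ℝ] E => T v) h2
  rw [h1, norm_smul, h.norm_vecDeriv, Real.sqrt_div h.pos.le, norm_inv, Real.norm_eq_abs,
    abs_of_nonneg (Real.sqrt_nonneg _)]
  ring

variable [μ.IsOpenPosMeasure]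

/-- Continuous representatives are unique because `μ` charges every nonempty open set. -/
theorem eq_of_isEvaluationMap (h : IsHomotheticEvaluation g μ E φ c C) {ψ : M → E}
    (hψ : IsEvaluationMap μ E ψ) : ψ = φ := by
  funext p
  refine ext_inner_right ℝ fun u => ?_
  obtain ⟨f, hf, hfu, hfp⟩ := hψ u
  rw [hfp]
  have := (hf.ae_eq_iff_eq μ (h.contMDiff_inner u).continuous).1 (hfu.symm.trans (h.ae_eq u))
  exact congrFun this p

variable [FiniteDimensional ℝ E]

/-- Uniqueness compares the lengths of one nonzero tangent vector, available since `0 < m`. -/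
theorem isScalingFactor_iff [Nonempty M] (h : IsHomotheticEvaluation g μ E φ c C) (hm : 0 < m)
    (hE : E ≠ ⊥) {s : ℝ} :
    IsScalingFactor g μ E s ↔ s = √(c / Module.finrank ℝ E) := by
  have hn := Submodule.finrank_cast_pos hE
  constructor
  · rintro ⟨ψ, hψ, -, -, -, hs⟩
    rw [h.eq_of_isEvaluationMap hψ] at hs
    obtain ⟨o⟩ := ‹Nonempty M›
    let v : EuclideanSpace ℝ (Fin m) := EuclideanSpace.single ⟨0, hm⟩ 1
    have hv : v ≠ 0 := by simp [v]
    have h1 : 0 < g.tangentNorm o v := Real.sqrt_pos.2 (g.pos o v hv)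
    exact (mul_right_cancel₀ h1.ne' ((h.norm_vecDeriv_unitMap o v).symm.trans (hs o v))).symm
  · rintro rfl
    refine ⟨φ, h.isEvaluationMap, fun p hp => ?_, ?_, ?_, h.norm_vecDeriv_unitMap⟩
    · have := h.norm_sq p
      rw [hp, norm_zero] at this
      exact hn.ne' (by rw [← this]; simp)
    · rw [h.unitMap_eq]
      exact ((√(Module.finrank ℝ E : ℝ))⁻¹ • ContinuousLinearMap.id ℝ E).contDiff.contMDiff.comp
        h.smooth
    · exact Real.sqrt_pos.2 (div_pos h.pos hn)

theorem sq_of_isScalingFactor [Nonempty M] (h : IsHomotheticEvaluation g μ E φ c C) (hm : 0 < m)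
    (hE : E ≠ ⊥) {s : ℝ} (hs : IsScalingFactor g μ E s) : s ^ 2 = c / Module.finrank ℝ E := by
  rw [(h.isScalingFactor_iff hm hE).1 hs, Real.sq_sqrt]
  exact div_nonneg h.pos.le (Nat.cast_nonneg _)

-- The smooth representative of `u` is forced to be `⟨φ, u⟩`, so the Laplacian of the class is
-- unambiguous.
omit [FiniteDimensional ℝ E] in
theorem hasLaplacian_iff (h : IsHomotheticEvaluation g μ E φ c C) (u : E) (w : Lp ℝ 2 μ) :
    HasLaplacian g μ u w ↔ w = C u := by
  have h1 : g.laplaceBeltrami (fun x => inner ℝ (φ x) u) = fun x => inner ℝ (φ x) (C u) :=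
    funext fun p => h.laplacian u p
  constructor
  · rintro ⟨f, hf, hfu, hfw⟩
    have := (hf.continuous.ae_eq_iff_eq μ (h.contMDiff_inner u).continuous).1
      (hfu.symm.trans (h.ae_eq u))
    rw [this, h1] at hfw
    exact Lp.ext (hfw.trans (h.ae_eq (C u)).symm)
  · rintro rfl
    exact ⟨_, h.contMDiff_inner u, h.ae_eq u, by rw [h1]; exact h.ae_eq (C u)⟩

omit [FiniteDimensional ℝ E] in
theorem isLaplacianOn_iff (h : IsHomotheticEvaluation g μ E φ c C) (D : E →ₗ[ℝ] E) :
    IsLaplacianOn g μ E D ↔ D = C := by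
  constructor
  · intro hD
    ext u
    rw [(h.hasLaplacian_iff u _).1 (hD u)]
  · rintro rfl u
    exact (h.hasLaplacian_iff u _).2 rfl

omit [FiniteDimensional ℝ E] in
/-- The squared factors add up over orthogonal decompositions. -/
theorem eq_sum_of_orthogonal [Nonempty M] (h : IsHomotheticEvaluation g μ E φ c C) (hm : 0 < m)
    {l : ℕ} {F : Fin l → Submodule ℝ (Lp ℝ 2 μ)} (hF : Pairwise fun i j => F i ⟂ F j)
    (hFE : ⨆ j, F j = E) {φ' : ∀ j, M → F j} {c' : Fin l → ℝ} {C' : ∀ j, F j →ₗ[ℝ] F j}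
    (h' : ∀ j, IsHomotheticEvaluation g μ (F j) (φ' j) (c' j) (C' j)) : c = ∑ j, c' j := by
  have hle : ∀ j, F j ≤ E := fun j => hFE ▸ le_iSup F j
  have horth : ∀ i j, i ≠ j → ∀ (u : F i) (v : F j), inner ℝ (u : Lp ℝ 2 μ) (v : Lp ℝ 2 μ) = 0 :=
    fun i j hij u v => (Submodule.isOrtho_iff_inner_eq.1 (hF hij)) u u.2 v v.2
  -- Both sides represent evaluation at `p` on every `F j`, hence on their span.
  have hsum : ∀ p, (φ p : Lp ℝ 2 μ) = ∑ j, (φ' j p : Lp ℝ 2 μ) := by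
    intro p
    have hmem : ∑ j, (φ' j p : Lp ℝ 2 μ) ∈ E := E.sum_mem fun j _ => hle j (φ' j p).2
    have h1 : ∀ u ∈ E, inner ℝ (φ p : Lp ℝ 2 μ) u = inner ℝ (∑ j, (φ' j p : Lp ℝ 2 μ)) u := by
      intro u hu
      rw [← hFE] at hu
      refine Submodule.iSup_induction F (motive := fun u => inner ℝ (φ p : Lp ℝ 2 μ) u =
        inner ℝ (∑ j, (φ' j p : Lp ℝ 2 μ)) u) hu (fun j u hu => ?_) (by simp) fun u v hu hv => ?_
      · rw [sum_inner, Finset.sum_eq_single j (fun i _ hij => horth i j hij _ ⟨u, hu⟩) (by simp)]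
        have h2 := ((h.contMDiff_inner ⟨u, hle j hu⟩).continuous.ae_eq_iff_eq μ
          ((h' j).contMDiff_inner ⟨u, hu⟩).continuous).1
          ((h.ae_eq ⟨u, hle j hu⟩).symm.trans ((h' j).ae_eq ⟨u, hu⟩))
        exact congrFun h2 p
      · rw [inner_add_right, inner_add_right, hu, hv]
    have h2 : φ p = ⟨_, hmem⟩ := ext_inner_right ℝ fun u => h1 u u.2
    exact congrArg Subtype.val h2
  have hcoe : ∀ (E : Submodule ℝ (Lp ℝ 2 μ)) {φ : M → E} (p : M),
      MDifferentiableAt (𝓡 m) 𝓘(ℝ, E) φ p → HasMFDerivAt (𝓡 m) 𝓘(ℝ, Lp ℝ 2 μ)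
        (fun x => (φ x : Lp ℝ 2 μ)) p
        (E.subtypeL.comp (mfderiv (𝓡 m) 𝓘(ℝ, E) φ p : EuclideanSpace ℝ (Fin m) →L[ℝ] E)) :=
    fun E φ p hφ => (E.subtypeL.hasFDerivAt (x := φ p)).hasMFDerivAt.comp p hφ.hasMFDerivAt
  have hder : ∀ p (v : TangentSpace (𝓡 m) p), ((vecDeriv φ p v : E) : Lp ℝ 2 μ) =
      ∑ j, ((vecDeriv (φ' j) p v : F j) : Lp ℝ 2 μ) := by
    intro p v
    let ev : (EuclideanSpace ℝ (Fin m) →L[ℝ] Lp ℝ 2 μ) →L[ℝ] Lp ℝ 2 μ :=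
      ContinuousLinearMap.apply ℝ (Lp ℝ 2 μ) (show EuclideanSpace ℝ (Fin m) from v)
    have h1 := hcoe E p (h.smooth.mdifferentiable (by simp) p)
    have h2 : HasMFDerivAt (𝓡 m) 𝓘(ℝ, Lp ℝ 2 μ) (∑ j, fun x => (φ' j x : Lp ℝ 2 μ)) p
        (∑ j, (F j).subtypeL.comp
          (mfderiv (𝓡 m) 𝓘(ℝ, F j) (φ' j) p : EuclideanSpace ℝ (Fin m) →L[ℝ] F j)) :=
      HasMFDerivAt.sum fun j _ => hcoe (F j) p ((h' j).smooth.mdifferentiable (by simp) p)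
    have h3 : (∑ j, fun x => (φ' j x : Lp ℝ 2 μ)) = fun x => (φ x : Lp ℝ 2 μ) := by
      funext x
      rw [hsum, Finset.sum_apply]
    rw [h3] at h2
    have h4 := congrArg ev (hasMFDerivAt_unique h1 h2)
    exact h4.trans (map_sum ev _ _)
  obtain ⟨o⟩ := ‹Nonempty M›
  obtain ⟨v, hpos⟩ : ∃ v : TangentSpace (𝓡 m) o, 0 < g.inner o v v := by
    let v : EuclideanSpace ℝ (Fin m) := EuclideanSpace.single ⟨0, hm⟩ 1
    have hv : v ≠ 0 := by simp [v]
    exact ⟨v, g.pos o v hv⟩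
  refine mul_right_cancel₀ hpos.ne' ((h.metric o v v).symm.trans ?_)
  -- Orthogonality of the `F j` removes the cross terms, so the pulled-back metrics add up.
  rw [Finset.sum_mul, Submodule.coe_inner, hder, sum_inner]
  refine Finset.sum_congr rfl fun i _ => ?_
  rw [inner_sum, Finset.sum_eq_single i (fun j _ hij => horth i j hij.symm _ _) (by simp)]
  exact (h' i).metric o v v

/-- The decomposition into the eigenspaces of the Laplacian. -/
theorem exists_isEigenDecomposition (h : IsHomotheticEvaluation g μ E φ c C)
    {G : Type*} [Group G] [MulAction G M]
    (hinv : ∀ (a : G) (u : E), ∃ w : E, (w : Lp ℝ 2 μ) =ᵐ[μ] (fun x => (u : Lp ℝ 2 μ) (a • x)) ∧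
      (C w : Lp ℝ 2 μ) =ᵐ[μ] fun x => (C u : Lp ℝ 2 μ) (a • x))
    (hG : ∀ a : G, Measure.QuasiMeasurePreserving (fun x : M => a • x) μ μ) :
    ∃ (l : ℕ) (F : Fin l → Submodule ℝ (Lp ℝ 2 μ)) (lam : Fin l → ℝ),
      IsEigenDecomposition G g μ E F lam := by
  let e := (Fintype.equivFin (Module.End.Eigenvalues C)).symm
  -- `C` is `Δ` itself and the convention is `Δ u = -λ u`, hence the minus sign.
  refine ⟨_, fun j => (Module.End.eigenspace C (e j : ℝ)).map E.subtype, fun j => -(e j : ℝ),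
    ⟨fun j => ?_, fun j => ?_, fun i j hij => ?_, ?_, fun j => ?_⟩⟩
  · exact fun h0 => (e j).2
      (Submodule.map_injective_of_injective E.subtype_injective (h0.trans (Submodule.map_bot _).symm))
  · rintro a _ ⟨u, hu, rfl⟩
    obtain ⟨w, hw, hCw⟩ := hinv a u
    refine ⟨w, ⟨w, ?_, rfl⟩, hw⟩
    rw [SetLike.mem_coe, Module.End.mem_eigenspace_iff] at hu ⊢
    refine Subtype.ext (Lp.ext (hCw.trans ?_))
    rw [hu]
    filter_upwards [hw, Lp.coeFn_smul (e j : ℝ) (w : Lp ℝ 2 μ),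
      (hG a).ae (Lp.coeFn_smul (e j : ℝ) (u : Lp ℝ 2 μ))] with x h1 h2 h3
    exact h3.trans ((congrArg _ h1.symm).trans h2.symm)
  · refine Submodule.isOrtho_iff_inner_eq.2 ?_
    rintro _ ⟨u, hu, rfl⟩ _ ⟨v, hv, rfl⟩
    have hij' : e i ≠ e j := e.injective.ne hij
    exact h.symmetric.orthogonalFamily_eigenspaces' hij' ⟨u, hu⟩ ⟨v, hv⟩
  · rw [← Submodule.map_iSup, e.iSup_comp (g := fun i : Module.End.Eigenvalues C => Module.End.eigenspace C (i : ℝ))]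
    have := h.symmetric.orthogonalComplement_iSup_eigenspaces_eq_bot'
    rw [Submodule.orthogonal_eq_bot_iff] at this
    rw [this, Submodule.map_top, Submodule.range_subtype]
  · rintro _ ⟨u, hu, rfl⟩
    rw [SetLike.mem_coe, Module.End.mem_eigenspace_iff] at hu
    refine (h.hasLaplacian_iff u _).2 ?_
    rw [hu, neg_neg]
    rfl

end IsHomotheticEvaluation

end HomotheticEvaluation

/-! ### Assembly and the main theorem. -/

section InvariantSubspaces

/-- Finitely many translates of a nonempty open set cover the compact space, so it cannot be null.
-/
theorem isOpenPosMeasure_of_isPretransitive (G : Type*) [Group G] {M : Type*} [TopologicalSpace M]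
    [CompactSpace M] [MulAction G M] [ContinuousConstSMul G M] [MulAction.IsPretransitive G M]
    [MeasurableSpace M] [BorelSpace M] (μ : Measure M) [IsProbabilityMeasure μ]
    [SMulInvariantMeasure G M μ] : μ.IsOpenPosMeasure :=
  ⟨fun _ hU hne => (measure_isOpen_pos_of_smulInvariant_of_compact_ne_zero G
    isCompact_univ (by simp) hU hne).ne'⟩

/-- The evaluation maps of the invariant spaces of functions orthogonal to the constants. -/
theorem exists_isHomotheticEvaluation {m k : ℕ} {M : Type*} [TopologicalSpace M] [T2Space M]
    [CompactSpace M] [ConnectedSpace M] [ChartedSpace (EuclideanSpace ℝ (Fin m)) M]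
    [IsManifold (𝓡 m) ∞ M] {g : RiemMetric m M} {G : Type*} [TopologicalSpace G] [T2Space G]
    [CompactSpace G] [ChartedSpace (EuclideanSpace ℝ (Fin k)) G] [Group G] [LieGroup (𝓡 k) ∞ G]
    [MulAction G M] [MulAction.IsPretransitive G M] [ContMDiffSMul (𝓡 k) (𝓡 m) ∞ G M]
    [MeasurableSpace M] [BorelSpace M] {μ : Measure M} [IsProbabilityMeasure μ]
    [SMulInvariantMeasure G M μ] (hisom : ActsByIsometries G g) (o : M)
    (hirr : IsotropyIrreducible m G o) (E : Submodule ℝ (Lp ℝ 2 μ)) [FiniteDimensional ℝ E]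
    (hE : E ≠ ⊥) (hinv : IsTranslationInvariant G μ E)
    (horth : ∀ u ∈ E, inner ℝ (Lp.const 2 μ (1 : ℝ)) u = 0) :
    0 < m ∧ ∃ (φ : M → E) (c : ℝ) (C : E →ₗ[ℝ] E), IsHomotheticEvaluation g μ E φ c C ∧
      ∀ (a : G) (u : E), ∃ w : E, (w : Lp ℝ 2 μ) =ᵐ[μ] (fun x => (u : Lp ℝ 2 μ) (a • x)) ∧
        (C w : Lp ℝ 2 μ) =ᵐ[μ] fun x => (C u : Lp ℝ 2 μ) (a • x) := by
  have : IsTopologicalGroup G := topologicalGroup_of_lieGroup (𝓡 k) ∞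
  have : ContinuousSMul G M := ContMDiffSMul.continuousSMul (I := 𝓡 k) (I' := 𝓡 m) ∞
  -- Second countability makes the Borel structure on `G × M` the product one, as the Fubini
  -- arguments require.
  have : SecondCountableTopology G :=
    ChartedSpace.secondCountable_of_sigmaCompact (EuclideanSpace ℝ (Fin k)) G
  have : SecondCountableTopology M :=
    ChartedSpace.secondCountable_of_sigmaCompact (EuclideanSpace ℝ (Fin m)) M
  obtain ⟨ρ, hρc, hρi, hρ⟩ := exists_translation_representation (G := G) hinv
  have hρs : ContMDiff (𝓡 k) 𝓘(ℝ, E →L[ℝ] E) ∞ ρ :=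
    contMDiff_of_continuous_monoidHom (R := E →L[ℝ] E) ρ hρc
  obtain ⟨φ, -, hφ, hφe⟩ := exists_equivariant_evaluation hρc hρi hρ
  have hnc : ¬ ∀ x y, φ x = φ y := fun h => hE (eq_bot_of_evaluation_const hφe horth h)
  have : Nontrivial M := by
    push Not at hnc
    obtain ⟨x, y, hxy⟩ := hnc
    exact ⟨x, y, fun h => hxy (congrArg φ h)⟩
  obtain ⟨hsurj, hm⟩ := surjective_mfderiv_orbit (k := k) o hirr
  have hφs : ContMDiff (𝓡 m) 𝓘(ℝ, E) ∞ φ := contMDiff_of_equivariant hρs hφ o hsurj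
  obtain ⟨c, hc, hg⟩ := exists_homothety hm (fun a => contMDiff_smul_left (k := k) a) hisom o hirr
    hρi hφs hφ hnc
  obtain ⟨C, hCs, hCρ, hCl, hCt⟩ := exists_casimir hm hisom o hirr hsurj hρs hρi hφs hφ hc hg
  have hnorm : ∀ x y, ‖φ x‖ = ‖φ y‖ := fun x y => by
    obtain ⟨a, rfl⟩ := MulAction.exists_smul_eq G x y
    rw [hφ, norm_eq_sqrt_real_inner, norm_eq_sqrt_real_inner (ρ a (φ x)), hρi]
  refine ⟨hm, φ, c, C, ⟨hφs, hφe, norm_sq_evaluation hφe hnorm, hc, hg, hCl, hCs,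
    trace_eq_of_evaluation hφe C hCt⟩, fun a u => ⟨ρ a⁻¹ u, ?_, ?_⟩⟩
  · simpa using hρ a⁻¹ u
  · rw [hCρ]
    simpa using hρ a⁻¹ (C u)

end InvariantSubspaces

theorem mainTheorem7 {m k : ℕ}
    -- a compact connected smooth `m`-manifold `M` with a Riemannian metric `g`
    {M : Type*} [TopologicalSpace M] [T2Space M] [CompactSpace M] [ConnectedSpace M]
    [ChartedSpace (EuclideanSpace ℝ (Fin m)) M] [IsManifold (𝓡 m) ∞ M] (g : RiemMetric m M)
    -- a compact Lie group `G`, acting smoothly and transitively on `M` by isometries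
    {G : Type*} [TopologicalSpace G] [T2Space G] [CompactSpace G]
    [ChartedSpace (EuclideanSpace ℝ (Fin k)) G] [Group G] [LieGroup (𝓡 k) ∞ G]
    [MulAction G M] [MulAction.IsPretransitive G M]
    [ContMDiffSMul (𝓡 k) (𝓡 m) ∞ G M] (hisom : ActsByIsometries G g)
    -- `M` is isotropy irreducible
    (o : M) (hirr : IsotropyIrreducible m G o)
    -- the invariant probability measure on `M`
    [MeasurableSpace M] [BorelSpace M] (μ : Measure M) [IsProbabilityMeasure μ]
    [SMulInvariantMeasure G M μ]
    -- a nonzero finite dimensional `G`-invariant subspace of `L²(M)` orthogonal to constants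
    (E : Submodule ℝ (Lp ℝ 2 μ)) [FiniteDimensional ℝ E] (hE : E ≠ ⊥)
    (hinv : IsTranslationInvariant G μ E)
    (horth : ∀ u ∈ E, inner ℝ (Lp.const 2 μ (1 : ℝ)) u = 0) :
    -- the scaling factor `s = s(E)` and the operator `Δ` on `E` are well defined
    (∃! s : ℝ, IsScalingFactor g μ E s) ∧
    (∃! D : E →ₗ[ℝ] E, IsLaplacianOn g μ E D) ∧
    -- `E` decomposes into eigenspaces
    (∃ (l : ℕ) (F : Fin l → Submodule ℝ (Lp ℝ 2 μ)) (lam : Fin l → ℝ),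
      IsEigenDecomposition G g μ E F lam) ∧
    -- `s² = |Tr Δ| / (m dim E)`
    (∀ (s : ℝ) (D : E →ₗ[ℝ] E), IsScalingFactor g μ E s → IsLaplacianOn g μ E D →
      s ^ 2 = |LinearMap.trace ℝ E D| / ((m : ℝ) * (Module.finrank ℝ E : ℝ))) ∧
    -- `s² = ∑ α_j s_j²` for every decomposition, where `α_j = dim E^j / dim E`, `s_j = s(E^j)`
    (∀ (l : ℕ) (F : Fin l → Submodule ℝ (Lp ℝ 2 μ)) (lam : Fin l → ℝ),
      IsEigenDecomposition G g μ E F lam →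
        (∀ j, ∃! t : ℝ, IsScalingFactor g μ (F j) t) ∧
        ∀ (s : ℝ) (t : Fin l → ℝ), IsScalingFactor g μ E s →
          (∀ j, IsScalingFactor g μ (F j) (t j)) →
          s ^ 2 = ∑ j, ((Module.finrank ℝ (F j) : ℝ) / (Module.finrank ℝ E : ℝ)) * t j ^ 2) ∧
    -- `s = √(λ / m)` if `E` consists of eigenfunctions of `-Δ` with the eigenvalue `λ`
    (∀ lam : ℝ, (∀ u ∈ E, HasLaplacian g μ u (-lam • u)) →
      ∀ s : ℝ, IsScalingFactor g μ E s → s = √(lam / (m : ℝ))) := by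
  obtain ⟨hm, φ, c, C, h, hC⟩ := exists_isHomotheticEvaluation (k := k) hisom o hirr E hE hinv horth
  have : ContinuousSMul G M := ContMDiffSMul.continuousSMul (I := 𝓡 k) (I' := 𝓡 m) ∞
  have hμ := isOpenPosMeasure_of_isPretransitive G μ
  have hn := Submodule.finrank_cast_pos hE
  have hm' : (0 : ℝ) < m := Nat.cast_pos.2 hm
  refine ⟨⟨_, (h.isScalingFactor_iff hm hE).2 rfl, fun s => (h.isScalingFactor_iff hm hE).1⟩,
    ⟨C, (h.isLaplacianOn_iff C).2 rfl, fun D => (h.isLaplacianOn_iff D).1⟩,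
    h.exists_isEigenDecomposition hC fun a => (measurePreserving_smul a μ).quasiMeasurePreserving,
    fun s D hs hD => ?_, fun l F lam hF => ?_, fun lam hlam s hs => ?_⟩
  · rw [h.sq_of_isScalingFactor hm hE hs, (h.isLaplacianOn_iff D).1 hD, h.trace, abs_neg,
      abs_of_pos (mul_pos h.pos hm'), mul_comm c, mul_div_mul_left _ _ hm'.ne']
  · have hle : ∀ j, F j ≤ E := fun j => hF.iSup_eq ▸ le_iSup F j
    have hfin : ∀ j, FiniteDimensional ℝ (F j) := fun j =>
      Submodule.finiteDimensional_of_le (hle j)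
    -- Each summand is itself a nonzero invariant space orthogonal to the constants.
    choose hm₀ φ' c' C' h' hC' using fun j => exists_isHomotheticEvaluation (k := k) hisom o hirr (F j)
      (hF.ne_bot j) (hF.invariant j) fun u hu => horth u (hle j hu)
    refine ⟨fun j => ⟨_, ((h' j).isScalingFactor_iff hm (hF.ne_bot j)).2 rfl,
      fun t => ((h' j).isScalingFactor_iff hm (hF.ne_bot j)).1⟩, fun s t hs ht => ?_⟩
    rw [h.sq_of_isScalingFactor hm hE hs, h.eq_sum_of_orthogonal hm hF.orthogonal hF.iSup_eq h',
      Finset.sum_div]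
    -- `t j ^ 2` is `c' j / dim (F j)`, so the weight `dim (F j) / dim E` turns it into `c' j / dim
    -- E`.
    refine Finset.sum_congr rfl fun j _ => ?_
    have hnj := Submodule.finrank_cast_pos (hF.ne_bot j)
    rw [(h' j).sq_of_isScalingFactor hm (hF.ne_bot j) (ht j)]
    field_simp
  · have hClam : C = -lam • LinearMap.id := by
      ext1 u
      exact Subtype.ext ((h.hasLaplacian_iff u _).1 (hlam u u.2)).symm
    -- Comparison of traces: `-lam * dim E = -(c * m)`.
    have htr := h.trace
    rw [hClam, map_smul, LinearMap.trace_id, smul_eq_mul] at htr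
    rw [(h.isScalingFactor_iff hm hE).1 hs]
    congr 1
    field_simp
    linarith
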